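/- **Model.** A radio network is a finite directed graph with $n\ge 2$ nodes that is strongly connected; an undirected (connected) network is the special case of a symmetric edge relation. $D$ is its eccentricity, the maximum distance between any two nodes. Every node knows $n$ and $D$, but nothing about the topology. Time is divided into synchronous steps. In a step a node either transmits a message to all its out-neighbours or listens. A listening node receives a message if and only if exactly one of its in-neighbours transmits in this step; otherwise it receives nothing (no collision detection). Nodes use private independent coins. Fix a constant $c\ge 1$ (an integer), write $\ell=\lceil\log_2 n\rceil$ and $\lambda=\lfloor\log_2\lfloor n/D\rfloor\rfloor+1$, and let messages be bit strings of length $16c\,\ell$. **Decay** with height $h\le \ell$ and a set $S$ of participants takes $h$ steps; in step $i=1,\dots,h$ each $u\in S$ transmits its message with probability $2^{-i}$, independently. **Partial multi-broadcast** with a set of sources, each holding a string, consists of $Q=K(D+\ell g)$ successive rounds of Decay, where $K$ is a constant and $g=\lfloor \ell/\lambda\rfloor+1$. Round $q=0,\dots,Q-1$ has height $\ell$ if $g\mid q$, and height $\min(\ell,\lambda+\nu_2(q+1))$ otherwise, where $\nu_2(k)$ is the exponent of $2$ in $k$. In each round all nodes that hold a string at its beginning participate with it, and a node without a string adopts the first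 one that it receives. The result at $v$ is the string that $v$ holds at the end ($\epsilon$ if none). **Selection** with a set $C$ of candidates with IDs: (1) $m(v)\gets$ partial multi-broadcast of the IDs from $C$. A node with $m(v)=\epsilon$ stops with output $(\epsilon,0)$. (2) For each bit position $i=1,\dots,16c\,\ell$, the nodes with $m(v)_i=1$ perform four rounds of Decay of height $\ell$ with message $m(v)$; a node with $m(v)_i=0$ that receives a string becomes a witness and replaces $m(v)$ by the larger of $m(v)$ and the (first) string received. (3) $p(v)\gets$ partial multi-broadcast of the strings $m(w)$ from the witnesses $w$. If $p(v)=\epsilon$ then $v$ outputs $(m(v),1)$, else $(p(v),0)$. **Leader election.** Each node repeats: it becomes a candidate with probability $1/n$; if it is a candidate, it chooses a uniformly random $16c\,\ell$-bit ID; all random choices are independent. Then $(m(v),b)\gets$ Selection. If $b=1$, then $v$ outputs $m(v)$ and terminates (and is silent from then on). The running time is the number of time steps until all nodes have terminated. A leader is correctly elected if all nodes terminate with the same output, and exactly one node has this output as its own ID (in the iteration in which it terminates). **Theorem.** For every integer $c\ge 1$ there are constants $K$ and $A$ such that on every strongly connected network with $n\ge2$ nodes and eccentricity $D$, directed or undirected,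 the expected running time of this algorithm is at most $$A\cdot\Bigl(D\,\max\bigl(1,\log_2\tfrac nD\bigr)+\log_2^2 n\Bigr)$$ (thus it is $O(D\log\frac nD+\log^2 n)$, with $\log\frac nD$ read as at least $1$), and with probability at least $1-n^{-c}$ it correctly elects a leader. -/

import Mathlib

open MeasureTheory
open scoped ENNReal

namespace RadioLE

universe u

/-! ### Networks

A network is a finite digraph; `G.Adj u v` means that `u` can send to `v`. An undirected network is
a digraph with a symmetric adjacency relation. -/

/-- Every node can be reached from every node along directed edges. -/
def StronglyConnected {V : Type u} (G : Digraph V) : Prop :=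
  ∀ u v : V, Relation.ReflTransGen G.Adj u v

/-- The length of a shortest directed walk from `u` to `v`. -/
noncomputable def hopDist {V : Type u} (G : Digraph V) (u v : V) : ℕ :=
  sInf {k : ℕ | ∃ p : ℕ → V, p 0 = u ∧ p k = v ∧ ∀ i < k, G.Adj (p i) (p (i + 1))}

/-- The eccentricity `D` of the network: the maximum distance between any two nodes. -/
noncomputable def eccentricity {V : Type u} [Fintype V] (G : Digraph V) : ℕ :=
  Finset.univ.sup fun u : V => Finset.univ.sup fun v : V => hopDist G u v

/-! ### One time step of the radio model without collision detection -/

open Classical in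
/-- `tx u = some x` means that `u` transmits `x` in this time step, `tx u = none` that it listens.
A node `v` receives a message iff it listens and exactly one of its in-neighbours transmits;
otherwise it receives nothing (`none`), whether zero or several in-neighbours transmit. -/
noncomputable def receive {V : Type u} {M : Type} (G : Digraph V) (tx : V → Option M) (v : V) :
    Option M :=
  if h : tx v = none ∧ ∃! u, G.Adj u v ∧ (tx u).isSome then tx h.2.exists.choose else none

/-- Bit strings of length `b`, used as identifiers and as messages. -/
abbrev BitString (b : ℕ) : Type := Fin b → Bool

/-- The larger of two bit strings, read as binary numbers with the most significant bit first. -/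
noncomputable def maxString {b : ℕ} (x y : BitString b) : BitString b :=
  ofLex (max (toLex x) (toLex y))

/-! ### Decay -/

/-- The coins of the nodes for one round of Decay: before step `i` (counted from `0`) node `v`
tosses the coin `coins v i`, which shows `true` with probability `2 ^ (-(i + 1))`. -/
abbrev DecayCoins (V : Type u) (l : ℕ) : Type u := V → Fin l → Bool

/-- One round of Decay, cut off after the first `h` of its `l` steps. The participants are the nodes
`u` with `msg u ≠ none`; in step `i` a participant transmits its message iff its coin for this
step shows `true`. The value at `v` is the first message that `v` receives, if any. -/
noncomputable def decay {V : Type u} {M : Type} {l : ℕ} (G : Digraph V) (h : ℕ)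
    (msg : V → Option M) (coins : DecayCoins V l) (v : V) : Option M :=
  (List.finRange l).findSome? fun i =>
    if i.val < h then receive G (fun u => if coins u i then msg u else none) v else none

/-! ### Partial multi-broadcast -/

/-- Partial multi-broadcast. The nodes that take part are those with `part v = true`; the sources
are the nodes with `f v ≠ none`. It consists of `Q` rounds of Decay, where round `q` is cut off
after `h q` steps. In each round all nodes that hold a message at its beginning participate with
that message; a node without a message adopts the first one that it receives and keeps it.
The value is the string `m(v)` interpreted by `v`, with `none` for the empty string. -/
noncomputable def multiBroadcast {V : Type u} {M : Type} {l Q : ℕ} (G : Digraph V) (h : ℕ → ℕ)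
    (part : V → Bool) (f : V → Option M) (coins : Fin Q → DecayCoins V l) : V → Option M :=
  (List.finRange Q).foldl
    (fun m (q : Fin Q) v => (m v).or (if part v then decay G (h q.val) m (coins q) v else none)) f

/-! ### Selection -/

/-- Iteration `j` of the loop of Selection. The state gives the current string `m(v)` of each node
and the set of witnesses. The nodes whose string has bit `j` equal to `1` perform four rounds of
Decay with their string; a node which has a string with bit `j` equal to `0` and receives a
string becomes a witness and keeps the larger of the two. -/
noncomputable def conflictStep {V : Type u} {b l : ℕ} (G : Digraph V) (j : Fin b)
    (coins : Fin 4 → DecayCoins V l) (s : V → Option (BitString b) × Bool) :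
    V → Option (BitString b) × Bool := fun v =>
  match (s v).1 with
  | none => s v
  | some x =>
    let heard : Option (BitString b) := (List.finRange 4).findSome? fun r =>
      decay G l (fun u => (s u).1.filter fun y => y j) (coins r) v
    match x j, heard with
    | false, some y => (some (maxString x y), true)
    | _, _ => s v

/-- Selection, performed by the nodes with `act v = true`, where `ids v` is the identifier of `v` if
`v` is a candidate and `none` otherwise. The value at `v` is the pair `(m(v), b)`. Nodes that
hold the empty string after the first broadcast stop there with output `(ε, 0)`. -/
noncomputable def selection {V : Type u} {b l Q : ℕ} (G : Digraph V) (h : ℕ → ℕ)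
    (act : V → Bool) (ids : V → Option (BitString b)) (coins₁ : Fin Q → DecayCoins V l)
    (coins₂ : Fin b → Fin 4 → DecayCoins V l) (coins₃ : Fin Q → DecayCoins V l) :
    V → Option (BitString b) × Bool :=
  let m₀ : V → Option (BitString b) := multiBroadcast G h act ids coins₁
  let s : V → Option (BitString b) × Bool :=
    (List.finRange b).foldl (fun s j => conflictStep G j (coins₂ j) s) fun v => (m₀ v, false)
  let p : V → Option (BitString b) :=
    multiBroadcast G h (fun v => (m₀ v).isSome) (fun v => if (s v).2 then (s v).1 else none) coins₃
  fun v =>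
    match m₀ v, p v with
    | none, _ => (none, false)
    | some _, none => ((s v).1, true)
    | some _, some y => (some y, false)

/-! ### Parameters known to all nodes: functions of `n`, `D` and the constants `c`, `K` -/

/-- `log n`, rounded up. -/
def logSize (n : ℕ) : ℕ := Nat.clog 2 n

/-- `max 1 (log (n / D))`, up to rounding. -/
def logRatio (n D : ℕ) : ℕ := Nat.log 2 (n / D) + 1

/-- The length `16 c log n` of the identifiers. -/
def idLength (c n : ℕ) : ℕ := 16 * c * logSize n

/-- Every so many rounds, the broadcast performs a full round of Decay. -/
def fullPeriod (n D : ℕ) : ℕ := logSize n / logRatio n D + 1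

/-- The number of rounds of Decay in one broadcast. -/
def numRounds (K n D : ℕ) : ℕ := K * (D + logSize n * fullPeriod n D)

/-- The number of steps of round `q` of a broadcast, so that a transmission probability `2 ^ (-k)`
is used in every round if `k ≤ log (n / D)`, in one out of `2 ^ j` rounds if
`k = log (n / D) + j`, and at least once in `O(log n)` steps in any case. -/
def roundHeight (n D q : ℕ) : ℕ :=
  if q % fullPeriod n D = 0 then logSize n
  else min (logSize n) (logRatio n D + padicValNat 2 (q + 1))

/-- The number of time steps of a partial multi-broadcast. -/
def broadcastSteps (K n D : ℕ) : ℕ := ∑ q ∈ Finset.range (numRounds K n D), roundHeight n D q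

/-- The number of time steps of one iteration of the main loop: two partial multi-broadcasts, and
four rounds of Decay for each bit of an identifier. -/
def iterationSteps (c K n D : ℕ) : ℕ :=
  2 * broadcastSteps K n D + idLength c n * 4 * logSize n

/-! ### Randomness -/

/-- A coin that shows `true` with probability `1 / k` and `false` otherwise (`k` positive). -/
noncomputable def coin (k : ℕ) : Measure Bool :=
  ProbabilityTheory.bernoulliMeasure true false
    ⟨(k : ℝ)⁻¹, inv_nonneg.mpr k.cast_nonneg, Nat.cast_inv_le_one k⟩

instance (k : ℕ) : IsProbabilityMeasure (coin k) := by
  unfold coin; infer_instance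

/-- The coins of all nodes in one iteration of the main loop. The components say which nodes become
candidates, which identifier each node uses if it is a candidate, and give the coins for the
first broadcast, for the detection of conflicts and for the second broadcast. -/
abbrev IterationCoins (V : Type u) (b l Q : ℕ) : Type u :=
  (V → Bool) × (V → BitString b) × (Fin Q → DecayCoins V l) ×
    (Fin b → Fin 4 → DecayCoins V l) × (Fin Q → DecayCoins V l)

/-- The law of the coins for one round of Decay. All coins of all nodes are independent. -/
noncomputable def decayLaw (V : Type u) [Fintype V] (l : ℕ) : Measure (DecayCoins V l) :=
  Measure.pi fun _ => Measure.pi fun i => coin (2 ^ (i.val + 1))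

instance (V : Type u) [Fintype V] (l : ℕ) : IsProbabilityMeasure (decayLaw V l) := by
  unfold decayLaw; infer_instance

/-- The law of the coins of one iteration: every node becomes a candidate with probability
`1 / n`, identifiers are uniform, and everything is independent. -/
noncomputable def iterationLaw (V : Type u) [Fintype V] (n b l Q : ℕ) :
    Measure (IterationCoins V b l Q) :=
  (Measure.pi fun _ => coin n).prod <|
  (Measure.pi fun _ => Measure.pi fun _ => coin 2).prod <|
  (Measure.pi fun _ => decayLaw V l).prod <|
  (Measure.pi fun _ => Measure.pi fun _ => decayLaw V l).prod <|
  Measure.pi fun _ => decayLaw V l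

instance (V : Type u) [Fintype V] (n b l Q : ℕ) : IsProbabilityMeasure (iterationLaw V n b l Q) := by
  unfold iterationLaw; infer_instance

/-- The coins of all nodes in all iterations of the main loop. -/
abbrev Coins (V : Type u) (b l Q : ℕ) : Type u := ℕ → IterationCoins V b l Q

/-- The law of all coins: the iterations are independent. -/
noncomputable def coinLaw (V : Type u) [Fintype V] (n b l Q : ℕ) : Measure (Coins V b l Q) :=
  Measure.infinitePi fun _ => iterationLaw V n b l Q

instance (V : Type u) [Fintype V] (n b l Q : ℕ) : IsProbabilityMeasure (coinLaw V n b l Q) := by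
  unfold coinLaw; infer_instance

/-! ### Leader election -/

/-- The status of a node: `none` as long as it is running, and `some (y, own)` once it has
terminated, where `y` is its output and `own` is the identifier that it had in the iteration in
which it terminated (`none` if it was not a candidate then). -/
abbrev Status (b : ℕ) : Type := Option (BitString b × Option (BitString b))

/-- One iteration of the main loop. Nodes that have terminated remain silent. -/
noncomputable def iteration {V : Type u} {b l Q : ℕ} (G : Digraph V) (h : ℕ → ℕ)
    (st : V → Status b) (r : IterationCoins V b l Q) : V → Status b :=
  let act : V → Bool := fun v => (st v).isNone
  let ids : V → Option (BitString b) := fun v => if act v && r.1 v then some (r.2.1 v) else none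
  let sel := selection G h act ids r.2.2.1 r.2.2.2.1 r.2.2.2.2
  fun v =>
    if act v then
      match sel v with
      | (some y, true) => some (y, ids v)
      | _ => none
    else st v

/-- The status of the nodes after `k` iterations. -/
noncomputable def run {V : Type u} {b l Q : ℕ} (G : Digraph V) (h : ℕ → ℕ) (ω : Coins V b l Q) :
    ℕ → V → Status b
  | 0 => fun _ => none
  | k + 1 => iteration G h (run G h ω k) (ω k)

/-- The number of time steps until all nodes have terminated (`∞` if this never happens), where each
iteration takes `T` time steps. -/
noncomputable def runningTime {V : Type u} {b l Q : ℕ} (G : Digraph V) (h : ℕ → ℕ) (T : ℕ)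
    (ω : Coins V b l Q) : ℝ≥0∞ :=
  ⨅ (k : ℕ) (_ : ∀ v, (run G h ω k v).isSome), ((T * k : ℕ) : ℝ≥0∞)

/-- All nodes terminate with the same output, and exactly one node has this output as its own
identifier. -/
def ElectsLeader {V : Type u} {b l Q : ℕ} (G : Digraph V) (h : ℕ → ℕ) (ω : Coins V b l Q) :
    Prop :=
  ∃ (k : ℕ) (y : BitString b),
    (∀ v, ∃ own, run G h ω k v = some (y, own)) ∧ ∃! v, run G h ω k v = some (y, some y)

/-- The law of the coins of the algorithm with constants `c` and `K` on the nodes `V` of a network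
of size `n` and eccentricity `D`. -/
noncomputable def algorithmLaw (c K n D : ℕ) (V : Type u) [Fintype V] :
    Measure (Coins V (idLength c n) (logSize n) (numRounds K n D)) :=
  coinLaw V n _ _ _

end RadioLE

namespace RadioLE

open ProbabilityTheory

universe u

/-! ### Potential functions along finite and infinite sequences of independent trials -/

/-! Four arguments are combined: a broadcast reaches everybody with high probability, conflicting
identifiers are noticed with high probability, the iterations form a chain with two good potentials,
and one iteration is short.

Broadcast. Fix a shortest path from a source to a node `v`, and let the front be the last index `j`
such that `p j` has an informed in-neighbour. The node `p j` itself is still silent unless `v` is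
informed, and all its informed in-neighbours have `p j` as their last out-neighbour on the path. The
sets `lastInNeighbors` are disjoint, so their sizes `k_j` add up to at most `n`. A round of height
at least `log k_j` informs `p j` with probability at least 0.18 (`decayLaw_decay_eq_none_le`), and
such a round occurs at least once in about `1 + D k_j / n` rounds. These waiting times sum to at
most `3 D` along the path (`sum_heightGap_le`). Concentration comes from an exponential potential of
elapsed rounds plus weighted remaining waiting time: it is a supermartingale
(`PathSchedule.lintegral_potential_le`), and Markov's inequality bounds the probability of missing
`v`. A union bound over `v` follows.

Detection. If two candidates hold different strings, strong connectivity gives an edge across which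
the strings differ. As long as there is no witness, no string changes, so all bit positions test the
same two strings with independent coins. Each bit of two random identifiers is missed with
probability at most `missRate`, and the expected number of ordered pairs of candidates is at most 1,
so no further union bound is lost (`iterationLaw_detectionFails_le`).

Chain. From the initial state, an iteration elects a leader with probability at least 0.35, leaves
the state unchanged, or goes wrong with probability `O(n ^ (-3 c))`. After going wrong, any running
node still terminates with probability at least `1 / (e n)` per iteration, because it may be the
only candidate. Hence `O(n ^ 2)` further iterations suffice in expectation, which the small
probability of going wrong outweighs; the expected number of iterations is at most 20. A second
potential, with values 0, `n ^ (-c)` and 1 on elected, initial and wrong states, bounds the error.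

Length. Full rounds are rare and `∑ ν₂(q + 1) ≤ Q`, so the average height of a round is `O(λ)` up to
an additive `ℓ` in total, and `λ g = O(ℓ)`. -/

/-- A potential whose expectation does not increase in any step does not increase in expectation
along a sequence of independent steps. -/
theorem lintegral_foldl_le {X : Type*} {σ : Type*} [MeasurableSpace X] [Finite X]
    [MeasurableSingletonClass X] (μ : Measure X) [IsProbabilityMeasure μ]
    (step : ℕ → σ → X → σ) (Φ : ℕ → σ → ℝ≥0∞)
    (hΦ : ∀ q s, ∫⁻ x, Φ (q + 1) (step q s x) ∂μ ≤ Φ q s) (Q : ℕ) :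
    ∀ (q₀ : ℕ) (s : σ),
      ∫⁻ x : Fin Q → X, Φ (q₀ + Q)
        ((List.finRange Q).foldl (fun s q => step (q₀ + q.val) s (x q)) s)
          ∂(Measure.pi fun _ => μ) ≤ Φ q₀ s := by
  induction Q with
  | zero => intro q₀ s; simp
  | succ Q ih =>
    intro q₀ s
    have hmp := (measurePreserving_piFinSuccAbove (fun _ : Fin (Q + 1) => μ) 0).symm
    rw [← hmp.lintegral_comp_emb (MeasurableEquiv.measurableEmbedding _),
      lintegral_prod _ (Measurable.of_discrete.aemeasurable)]
    refine le_trans (lintegral_mono fun x => ?_) (hΦ q₀ s)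
    refine le_trans (le_of_eq ?_) (ih (q₀ + 1) (step q₀ s x))
    refine lintegral_congr fun y => ?_
    simp only [List.finRange_succ, List.foldl_cons, List.foldl_map]
    rw [show q₀ + (Q + 1) = q₀ + 1 + Q by ring]
    congr 1
    have : ∀ (q : Fin Q) , q₀ + (Fin.succ q).val = q₀ + 1 + q.val := by
      intro q; rw [Fin.val_succ]; ring
    simp only [this]
    rfl

/-- The states of a chain driven by a sequence of inputs. -/
def chain {X : Type*} {σ : Type*} (step : σ → X → σ) (s : σ) (ω : ℕ → X) : ℕ → σ
  | 0 => s
  | k + 1 => step (chain step s ω k) (ω k)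

theorem measurable_chain {X : Type*} {σ : Type*} [MeasurableSpace X] [MeasurableSpace σ]
    [Countable σ] [MeasurableSingletonClass σ] [Countable X] [MeasurableSingletonClass X]
    (step : σ → X → σ) (s : σ) (k : ℕ) : Measurable fun ω => chain step s ω k := by
  induction k with
  | zero => exact measurable_const
  | succ k ih =>
    exact (Measurable.of_discrete (f := fun z : σ × X => step z.1 z.2)).comp
      (ih.prodMk (measurable_pi_apply k))

/-- The chain up to time `k` is independent of the input at time `k`. -/
theorem map_chain_prod {X : Type*} {σ : Type*} [MeasurableSpace X] [MeasurableSpace σ]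
    [Countable σ] [MeasurableSingletonClass σ] [Countable X] [MeasurableSingletonClass X]
    (μ : Measure X) [IsProbabilityMeasure μ] (step : σ → X → σ) (s : σ) (k : ℕ) :
    (Measure.infinitePi fun _ : ℕ => μ).map (fun ω => (chain step s ω k, ω k)) =
      ((Measure.infinitePi fun _ : ℕ => μ).map fun ω => chain step s ω k).prod μ := by
  have hind : iIndepFun (fun (i : ℕ) (ω : ℕ → X) => ω i) (Measure.infinitePi fun _ : ℕ => μ) :=
    iIndepFun_infinitePi (X := fun _ x => x) fun _ => measurable_id
  have h := hind.indepFun_finset (Finset.range k) {k} (by simp) fun i => measurable_pi_apply i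
  obtain ⟨x₀⟩ : Nonempty X := nonempty_of_isProbabilityMeasure μ
  -- Padding the first `k` inputs with an arbitrary `x₀` exhibits the state at time `k` as a
  -- function of these inputs alone, so independence of disjoint blocks of coordinates applies.
  let extend : (Finset.range k → X) → ℕ → X := fun a i =>
    if hi : i ∈ Finset.range k then a ⟨i, hi⟩ else x₀
  have hextend : ∀ ω : ℕ → X, ∀ j ≤ k,
      chain step s (extend fun i => ω i) j = chain step s ω j := by
    intro ω j
    induction j with
    | zero => intro _; rfl
    | succ j ih =>
      intro hj
      have hlt : j < k := hj
      simp only [chain, ih (by omega)]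
      congr 1
      simp [extend, hlt]
  have hφ : Measurable fun a : Finset.range k → X => chain step s (extend a) k :=
    Measurable.of_discrete
  have h2 := h.comp hφ (measurable_pi_apply (⟨k, by simp⟩ : ({k} : Finset ℕ)))
  have h3 : IndepFun (fun ω => chain step s ω k) (fun ω => ω k)
      (Measure.infinitePi fun _ : ℕ => μ) := by
    convert h2 using 1
    · funext ω
      exact (hextend ω k le_rfl).symm
    · rfl
  rw [h3.map_prod_eq_prod_map_map (measurable_chain step s k).aemeasurable
    (measurable_pi_apply k).aemeasurable, Measure.infinitePi_map_eval]

theorem lintegral_chain_succ {X : Type*} {σ : Type*} [MeasurableSpace X]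
    [Countable σ] [Countable X] [MeasurableSingletonClass X]
    (μ : Measure X) [IsProbabilityMeasure μ] (step : σ → X → σ) (s : σ) (Φ Ψ : σ → ℝ≥0∞)
    (hΦ : ∀ s, ∫⁻ x, Φ (step s x) ∂μ ≤ Ψ s) (k : ℕ) :
    ∫⁻ ω, Φ (chain step s ω (k + 1)) ∂(Measure.infinitePi fun _ : ℕ => μ) ≤
      ∫⁻ ω, Ψ (chain step s ω k) ∂(Measure.infinitePi fun _ : ℕ => μ) := by
  -- The state space is countable, so the discrete σ-algebra makes every potential measurable; it
  -- need not appear in the statement.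
  let _ : MeasurableSpace σ := ⊤
  have hm := measurable_chain (X := X) step s k
  calc ∫⁻ ω, Φ (chain step s ω (k + 1)) ∂(Measure.infinitePi fun _ : ℕ => μ)
      = ∫⁻ z : σ × X, Φ (step z.1 z.2)
          ∂((Measure.infinitePi fun _ : ℕ => μ).map (fun ω => (chain step s ω k, ω k))) := by
        rw [lintegral_map Measurable.of_discrete (hm.prodMk (measurable_pi_apply k))]
        rfl
    _ = ∫⁻ t, ∫⁻ x, Φ (step t x) ∂μ
          ∂((Measure.infinitePi fun _ : ℕ => μ).map fun ω => chain step s ω k) := by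
        rw [map_chain_prod, lintegral_prod _ Measurable.of_discrete.aemeasurable]
    _ ≤ ∫⁻ t, Ψ t ∂((Measure.infinitePi fun _ : ℕ => μ).map fun ω => chain step s ω k) :=
        lintegral_mono hΦ
    _ = _ := lintegral_map Measurable.of_discrete hm

/-- A bound `W` for the expected total cost of a chain, from a one-step inequality. -/
theorem tsum_lintegral_chain_le {X : Type*} {σ : Type*} [MeasurableSpace X]
    [Countable σ] [Countable X] [MeasurableSingletonClass X]
    (μ : Measure X) [IsProbabilityMeasure μ] (step : σ → X → σ) (s : σ) (cost W : σ → ℝ≥0∞)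
    (hW : ∀ s, cost s + ∫⁻ x, W (step s x) ∂μ ≤ W s) :
    ∑' k, ∫⁻ ω, cost (chain step s ω k) ∂(Measure.infinitePi fun _ : ℕ => μ) ≤ W s := by
  let _ : MeasurableSpace σ := ⊤
  refine ENNReal.tsum_le_of_sum_range_le fun N => ?_
  have key : ∀ N, ∑ k ∈ Finset.range N,
        ∫⁻ ω, cost (chain step s ω k) ∂(Measure.infinitePi fun _ : ℕ => μ) +
      ∫⁻ ω, W (chain step s ω N) ∂(Measure.infinitePi fun _ : ℕ => μ) ≤ W s := by
    intro N
    induction N with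
    | zero => simp [chain]
    | succ N ih =>
      refine le_trans ?_ ih
      rw [Finset.sum_range_succ, add_assoc]
      gcongr
      have hc : Measurable fun ω => cost (chain (X := X) step s ω N) :=
        Measurable.of_discrete.comp (measurable_chain step s N)
      calc _ ≤ ∫⁻ ω, cost (chain step s ω N) ∂(Measure.infinitePi fun _ : ℕ => μ) +
            ∫⁻ ω, (∫⁻ x, W (step (chain step s ω N) x) ∂μ)
              ∂(Measure.infinitePi fun _ : ℕ => μ) := by
            refine add_le_add le_rfl ?_
            exact lintegral_chain_succ μ step s W (fun t => ∫⁻ x, W (step t x) ∂μ)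
              (fun _ => le_rfl) N
        _ = ∫⁻ ω, (cost (chain step s ω N) + ∫⁻ x, W (step (chain step s ω N) x) ∂μ)
              ∂(Measure.infinitePi fun _ : ℕ => μ) := (lintegral_add_left hc _).symm
        _ ≤ _ := lintegral_mono fun ω => hW _
  exact le_trans le_self_add (key N)

theorem lintegral_chain_le {X : Type*} {σ : Type*} [MeasurableSpace X]
    [Countable σ] [Countable X] [MeasurableSingletonClass X]
    (μ : Measure X) [IsProbabilityMeasure μ] (step : σ → X → σ) (s : σ) (Φ : σ → ℝ≥0∞)
    (hΦ : ∀ s, ∫⁻ x, Φ (step s x) ∂μ ≤ Φ s) (k : ℕ) :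
    ∫⁻ ω, Φ (chain step s ω k) ∂(Measure.infinitePi fun _ : ℕ => μ) ≤ Φ s := by
  induction k with
  | zero => simp [chain]
  | succ k ih => exact (lintegral_chain_succ μ step s Φ Φ hΦ k).trans ih

/-- Freezes the coins of earlier phases: a bound uniform in them survives integration. -/
theorem measure_prod_le_of_forall {X Y : Type*} [MeasurableSpace X] [MeasurableSpace Y]
    [Countable X] [Countable Y] [MeasurableSingletonClass X] [MeasurableSingletonClass Y]
    (μ : Measure X) (ν : Measure Y) [IsProbabilityMeasure μ] [IsProbabilityMeasure ν]
    (S : Set (X × Y)) (ε : ℝ≥0∞) (h : ∀ x, ν {y | (x, y) ∈ S} ≤ ε) : μ.prod ν S ≤ ε := by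
  rw [Measure.prod_apply (MeasurableSet.of_discrete)]
  calc ∫⁻ x, ν (Prod.mk x ⁻¹' S) ∂μ ≤ ∫⁻ _, ε ∂μ := lintegral_mono fun x => h x
    _ = ε := by simp

theorem measure_prod_fst {X Y : Type*} [MeasurableSpace X] [MeasurableSpace Y]
    (μ : Measure X) (ν : Measure Y) [SFinite μ] [IsProbabilityMeasure ν]
    (P : X → Prop) : μ.prod ν {z | P z.1} = μ {x | P x} := by
  have : {z : X × Y | P z.1} = {x | P x} ×ˢ Set.univ := by ext; simp
  rw [this, Measure.prod_prod]; simp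

/-! ### Coins -/

theorem coin_true (k : ℕ) : coin k {true} = ENNReal.ofReal ((k : ℝ)⁻¹) := by
  classical
  unfold coin
  rw [bernoulliMeasure_apply _ (MeasurableSet.singleton _)]
  simp [ENNReal.ofReal, unitInterval.toNNReal, Real.toNNReal_of_nonneg]
  rfl

theorem coin_false (k : ℕ) : coin k {false} = ENNReal.ofReal (1 - (k : ℝ)⁻¹) := by
  have h := prob_compl_eq_one_sub (μ := coin k) (MeasurableSet.singleton true)
  have h2 : ({true} : Set Bool)ᶜ = {false} := by ext b; cases b <;> simp
  rw [h2, coin_true] at h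
  rw [h, ENNReal.ofReal_sub _ (by positivity), ENNReal.ofReal_one]

/-- `(1 - 1 / N) ^ (N - 1) ≥ 1 / e`. -/
theorem exp_neg_one_le_pow (N k : ℕ) (hN : 2 ≤ N) (hk : k ≤ N - 1) :
    Real.exp (-1) ≤ (1 - (N : ℝ)⁻¹) ^ k := by
  have hN' : (2 : ℝ) ≤ N := by exact_mod_cast hN
  have hpos : (0 : ℝ) < 1 - (N : ℝ)⁻¹ := by
    rw [sub_pos]; exact inv_lt_one_of_one_lt₀ (by linarith)
  have h1 : (1 - (N : ℝ)⁻¹) ^ (N - 1) ≤ (1 - (N : ℝ)⁻¹) ^ k :=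
    pow_le_pow_of_le_one hpos.le (by simp) hk
  refine le_trans ?_ h1
  have hm : ((N - 1 : ℕ) : ℝ) = N - 1 := by push_cast [show 1 ≤ N by omega]; ring
  have hinv : (1 - (N : ℝ)⁻¹)⁻¹ = 1 + 1 / ((N : ℝ) - 1) := by
    have : (N : ℝ) - 1 ≠ 0 := by linarith
    have : (N : ℝ) ≠ 0 := by linarith
    rw [show 1 - (N : ℝ)⁻¹ = (N - 1) / N by field_simp]
    field_simp
    ring
  have h2 : (1 + 1 / ((N : ℝ) - 1)) ^ (N - 1) ≤ Real.exp 1 := by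
    calc (1 + 1 / ((N : ℝ) - 1)) ^ (N - 1) ≤ (Real.exp (1 / ((N : ℝ) - 1))) ^ (N - 1) := by
          apply pow_le_pow_left₀
          · have : (0 : ℝ) ≤ 1 / ((N : ℝ) - 1) := by apply div_nonneg <;> linarith
            linarith
          · rw [add_comm]; exact Real.add_one_le_exp _
      _ = Real.exp 1 := by
          rw [← Real.exp_nat_mul, hm]
          congr 1
          have : (N : ℝ) - 1 ≠ 0 := by linarith
          field_simp
  rw [Real.exp_neg, ← hinv, inv_pow] at *
  exact inv_le_of_inv_le₀ (pow_pos hpos _) h2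

theorem exp_neg_one_ge : (0.3678 : ℝ) ≤ Real.exp (-1) := by
  have := Real.exp_neg_one_gt_d9
  linarith

/-! ### Exactly one success among independent trials -/

/-- The event that `u` is the only element of `J` with a success. -/
theorem measure_pi_only {V Ω : Type*} [Fintype V] [MeasurableSpace Ω] (ν : Measure Ω)
    [IsProbabilityMeasure ν] (T : Set Ω) (J : Finset V) (u : V) (hu : u ∈ J) :
    (Measure.pi fun _ : V => ν) {f | f u ∈ T ∧ ∀ w ∈ J, w ≠ u → f w ∈ Tᶜ} =
      ν T * ν Tᶜ ^ (J.card - 1) := by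
  classical
  have hset : {f : V → Ω | f u ∈ T ∧ ∀ w ∈ J, w ≠ u → f w ∈ Tᶜ} =
      Set.univ.pi fun w => if w = u then T else if w ∈ J then Tᶜ else Set.univ := by
    ext f
    simp only [Set.mem_ofPred_eq, Set.mem_univ_pi]
    constructor
    · rintro ⟨h1, h2⟩ w
      split_ifs with h3 h4
      · exact h3 ▸ h1
      · exact h2 w h4 h3
      · trivial
    · intro h
      refine ⟨by simpa using h u, fun w hw hwu => ?_⟩
      simpa [hw, hwu] using h w
  rw [hset, Measure.pi_pi]
  rw [← Finset.mul_prod_erase Finset.univ _ (Finset.mem_univ u), if_pos rfl]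
  congr 1
  rw [← Finset.card_erase_of_mem hu, ← Finset.prod_const]
  symm
  apply Finset.prod_subset_one_on_sdiff (Finset.erase_subset_erase u (Finset.subset_univ J))
  · intro w hw
    simp only [Finset.mem_sdiff, Finset.mem_erase, Finset.mem_univ, not_and] at hw
    rw [if_neg hw.1.1, if_neg (hw.2 hw.1.1)]
    exact measure_univ
  · intro w hw
    rw [Finset.mem_erase] at hw
    rw [if_neg hw.1, if_pos hw.2]

theorem le_measure_pi_only {V Ω : Type*} [Fintype V] [MeasurableSpace Ω] (ν : Measure Ω)
    [IsProbabilityMeasure ν] (T : Set Ω) (J : Finset V) (u : V) (hu : u ∈ J)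
    (N : ℕ) (hN : 2 ≤ N) (hJ : J.card ≤ N) (hT : ν T = ENNReal.ofReal ((N : ℝ)⁻¹))
    (hT' : ν Tᶜ = ENNReal.ofReal (1 - (N : ℝ)⁻¹)) :
    ENNReal.ofReal ((N : ℝ)⁻¹ * Real.exp (-1)) ≤
      (Measure.pi fun _ : V => ν) {f | f u ∈ T ∧ ∀ w ∈ J, w ≠ u → f w ∈ Tᶜ} := by
  rw [measure_pi_only ν T J u hu, hT, hT', ← ENNReal.ofReal_pow, ← ENNReal.ofReal_mul]
  · apply ENNReal.ofReal_le_ofReal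
    gcongr
    exact exp_neg_one_le_pow N _ hN (by omega)
  · positivity
  · rw [sub_nonneg]; exact Nat.cast_inv_le_one N

/-- The events "only `u` succeeds" are disjoint for different `u`, so their probabilities add
exactly. This serves both one step of Decay and the choice of candidates. -/
theorem le_measure_pi_exists_only {V Ω : Type*} [Fintype V] [MeasurableSpace Ω] (ν : Measure Ω)
    [IsProbabilityMeasure ν] (T : Set Ω) (hTm : MeasurableSet T) (J : Finset V)
    (N : ℕ) (hN : 2 ≤ N) (hJ : J.card ≤ N) (hT : ν T = ENNReal.ofReal ((N : ℝ)⁻¹))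
    (hT' : ν Tᶜ = ENNReal.ofReal (1 - (N : ℝ)⁻¹)) :
    ENNReal.ofReal (J.card * ((N : ℝ)⁻¹ * Real.exp (-1))) ≤
      (Measure.pi fun _ : V => ν) {f | ∃ u ∈ J, f u ∈ T ∧ ∀ w ∈ J, w ≠ u → f w ∈ Tᶜ} := by
  have hset : {f : V → Ω | ∃ u ∈ J, f u ∈ T ∧ ∀ w ∈ J, w ≠ u → f w ∈ Tᶜ} =
      ⋃ u ∈ J, {f | f u ∈ T ∧ ∀ w ∈ J, w ≠ u → f w ∈ Tᶜ} := by
    ext f; simp only [Set.mem_iUnion, Set.mem_ofPred_eq, exists_prop]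
  rw [hset, measure_biUnion_finset]
  · rw [ENNReal.ofReal_mul (by positivity), ENNReal.ofReal_natCast, ← nsmul_eq_mul]
    exact Finset.card_nsmul_le_sum _ _ _ fun u hu =>
      le_measure_pi_only ν T J u hu N hN hJ hT hT'
  · intro u hu w hw huw
    rw [Function.onFun, Set.disjoint_left]
    rintro f ⟨h1, h2⟩ ⟨h3, -⟩
    exact h2 w hw huw.symm h3
  · intro u _
    have : {f : V → Ω | f u ∈ T ∧ ∀ w ∈ J, w ≠ u → f w ∈ Tᶜ} =
        (fun f => f u) ⁻¹' T ∩ ⋂ w ∈ J, ⋂ (_ : w ≠ u), (fun f => f w) ⁻¹' Tᶜ := by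
      ext f; simp
    rw [this]
    refine (measurable_pi_apply u hTm).inter ?_
    refine Finset.measurableSet_biInter _ fun w _ => MeasurableSet.iInter fun _ => ?_
    exact measurable_pi_apply w hTm.compl

/-! ### One round of Decay -/

theorem receive_isSome {V : Type u} {M : Type} (G : Digraph V) (tx : V → Option M) (v u : V)
    (hv : tx v = none) (hu : G.Adj u v) (hu' : (tx u).isSome)
    (huniq : ∀ w, G.Adj w v → (tx w).isSome → w = u) : (receive G tx v).isSome := by
  have h : tx v = none ∧ ∃! u, G.Adj u v ∧ (tx u).isSome :=
    ⟨hv, u, ⟨hu, hu'⟩, fun w hw => huniq w hw.1 hw.2⟩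
  rw [receive, dif_pos h]
  exact h.2.exists.choose_spec.2

theorem decay_isSome {V : Type u} {M : Type} {l : ℕ} (G : Digraph V) (h : ℕ)
    (msg : V → Option M) (coins : DecayCoins V l) (v : V) (i : Fin l) (hi : i.val < h)
    (hr : (receive G (fun u => if coins u i then msg u else none) v).isSome) :
    (decay G h msg coins v).isSome := by
  rw [decay, List.findSome?_isSome_iff]
  exact ⟨i, List.mem_finRange i, by rw [if_pos hi]; exact hr⟩

theorem pi_coin_eval_true (l : ℕ) (i : Fin l) :
    (Measure.pi fun i : Fin l => coin (2 ^ (i.val + 1))) {f | f i = true} =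
      ENNReal.ofReal (((2 ^ (i.val + 1) : ℕ) : ℝ)⁻¹) := by
  rw [← coin_true]
  exact (measurePreserving_eval (fun i : Fin l => coin (2 ^ (i.val + 1))) i).measure_preimage
    (MeasurableSet.singleton true).nullMeasurableSet

theorem pi_coin_eval_false (l : ℕ) (i : Fin l) :
    (Measure.pi fun i : Fin l => coin (2 ^ (i.val + 1))) {f | f i = true}ᶜ =
      ENNReal.ofReal (1 - ((2 ^ (i.val + 1) : ℕ) : ℝ)⁻¹) := by
  rw [← coin_false, ← (measurePreserving_eval (fun i : Fin l => coin (2 ^ (i.val + 1))) i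
    ).measure_preimage (MeasurableSet.singleton false).nullMeasurableSet]
  congr 1
  ext f
  simp

/-- A silent node with between `1` and `2 ^ h` participating in-neighbours receives a message
in a round of Decay of height `h` with constant probability. -/
theorem decayLaw_decay_eq_none_le {V : Type u} [Fintype V] {M : Type} {l : ℕ} (G : Digraph V)
    (h : ℕ) (msg : V → Option M) (v : V) (hv : msg v = none)
    (hne : ∃ u, G.Adj u v ∧ (msg u).isSome) (I : Finset V)
    (hI : ∀ u, G.Adj u v → (msg u).isSome → u ∈ I) (hcard : I.card ≤ 2 ^ h) (h1 : 1 ≤ h)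
    (hl : h ≤ l) :
    decayLaw V l {coins | decay G h msg coins v = none} ≤ ENNReal.ofReal 0.82 := by
  classical
  let J : Finset V := Finset.univ.filter fun u => G.Adj u v ∧ (msg u).isSome
  have hJI : J ⊆ I := fun u hu => by
    simp only [J, Finset.mem_filter] at hu; exact hI u hu.2.1 hu.2.2
  have hJpos : 1 ≤ J.card := by
    obtain ⟨u, hu⟩ := hne
    exact Finset.card_pos.2 ⟨u, by simp [J, hu]⟩
  have hJh : J.card ≤ 2 ^ h := (Finset.card_le_card hJI).trans hcard
  -- The step of Decay whose transmission probability `2 ^ (-(i + 1))` is within a factor 2 of the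
  -- inverse number of senders. A single sender uses `i = 0`, which is why height at least 1 is
  -- needed.
  obtain ⟨i, hih, hJi, hiJ⟩ : ∃ i, i < h ∧ J.card ≤ 2 ^ (i + 1) ∧ 2 ^ (i + 1) ≤ 2 * J.card := by
    rcases Nat.lt_or_ge 1 J.card with hJ | hJ
    · have hc : 0 < Nat.clog 2 J.card := Nat.clog_pos (by norm_num) hJ
      refine ⟨Nat.clog 2 J.card - 1, ?_, ?_, ?_⟩
      · have := (Nat.clog_le_iff_le_pow (b := 2) (by norm_num)).2 hJh
        omega
      · rw [Nat.sub_add_cancel hc]; exact Nat.le_pow_clog (by norm_num) _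
      · have := Nat.pow_pred_clog_lt_self (b := 2) (by norm_num) hJ
        rw [Nat.pred_eq_sub_one] at this
        rw [pow_succ]; omega
    · exact ⟨0, by omega, by omega, by omega⟩
  let i' : Fin l := ⟨i, by omega⟩
  have hsub : {coins : DecayCoins V l | decay G h msg coins v = none} ⊆
      {f | ∃ u ∈ J, f u ∈ {f : Fin l → Bool | f i' = true} ∧
        ∀ w ∈ J, w ≠ u → f w ∈ {f : Fin l → Bool | f i' = true}ᶜ}ᶜ := by
    rintro coins hc ⟨u, hu, hut, hw⟩
    simp only [J, Finset.mem_filter, Finset.mem_univ, true_and] at hu hw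
    have hsome := decay_isSome G h msg coins v i' hih
      (receive_isSome G _ v u (by simp [hv]) hu.1 (by
        have : coins u i' = true := hut
        simp [this, hu.2]) (by
        intro w hwv hws
        by_contra hne
        by_cases hcw : coins w i' = true
        · simp only [hcw, if_true] at hws
          exact hw w ⟨hwv, hws⟩ hne hcw
        · simp [hcw] at hws))
    rw [Set.mem_ofPred_eq] at hc
    simp [hc] at hsome
  have hpos := le_measure_pi_exists_only
    (Measure.pi fun i : Fin l => coin (2 ^ (i.val + 1))) {f | f i' = true}
    MeasurableSet.of_discrete J (2 ^ (i + 1))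
    (by rw [pow_succ]; have := Nat.one_le_two_pow (n := i); omega) hJi
    (pi_coin_eval_true l i') (pi_coin_eval_false l i')
  refine (measure_mono hsub).trans ?_
  rw [prob_compl_eq_one_sub MeasurableSet.of_discrete]
  -- Exactly one sender has probability at least `1 / (2 e)`, which exceeds 0.18.
  have h18 : ENNReal.ofReal 0.18 ≤ ENNReal.ofReal
      (J.card * (((2 ^ (i + 1) : ℕ) : ℝ)⁻¹ * Real.exp (-1))) := by
    apply ENNReal.ofReal_le_ofReal
    have e := exp_neg_one_ge
    have h2 : ((2 ^ (i + 1) : ℕ) : ℝ) ≤ 2 * J.card := by exact_mod_cast hiJ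
    have h3 : (0 : ℝ) < ((2 ^ (i + 1) : ℕ) : ℝ) := by positivity
    have h4 : (1 / 2 : ℝ) ≤ J.card * ((2 ^ (i + 1) : ℕ) : ℝ)⁻¹ := by
      rw [← div_eq_mul_inv, div_le_div_iff₀ (by norm_num) h3]; linarith
    rw [← mul_assoc]
    nlinarith
  calc _ ≤ 1 - ENNReal.ofReal 0.18 := tsub_le_tsub_left (h18.trans hpos) 1
    _ = ENNReal.ofReal 0.82 := by
      rw [← ENNReal.ofReal_one, ← ENNReal.ofReal_sub _ (by norm_num)]; norm_num

/-! ### Progress of a broadcast along a path -/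

/-- One round of a broadcast. -/
noncomputable def broadcastStep {V : Type u} {M : Type} {l : ℕ} (G : Digraph V) (h : ℕ → ℕ)
    (part : V → Bool) (q : ℕ) (m : V → Option M) (coins : DecayCoins V l) : V → Option M :=
  fun v => (m v).or (if part v then decay G (h q) m coins v else none)

theorem multiBroadcast_eq_foldl {V : Type u} {M : Type} {l Q : ℕ} (G : Digraph V) (h : ℕ → ℕ)
    (part : V → Bool) (f : V → Option M) (coins : Fin Q → DecayCoins V l) :
    multiBroadcast G h part f coins =
      (List.finRange Q).foldl (fun m q => broadcastStep G h part (0 + q.val) m (coins q)) f := by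
  simp only [zero_add]
  rfl

theorem broadcastStep_isSome {V : Type u} {M : Type} {l : ℕ} (G : Digraph V) (h : ℕ → ℕ)
    (part : V → Bool) (q : ℕ) (m : V → Option M) (coins : DecayCoins V l) (v : V)
    (hv : (m v).isSome) : (broadcastStep G h part q m coins v).isSome := by
  rw [broadcastStep, Option.isSome_or, hv, Bool.true_or]

section Path

variable {V : Type u} {M : Type}

open Classical in
/-- The nodes whose last out-neighbour among `p 0, …, p d` is `p j`. -/
noncomputable def lastInNeighbors [Fintype V] (G : Digraph V) (p : ℕ → V) (d j : ℕ) : Finset V :=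
  Finset.univ.filter fun w => G.Adj w (p j) ∧ ∀ i, j < i → i ≤ d → ¬ G.Adj w (p i)

/-- The height from which on Decay works for up to `k` participants. -/
def neededHeight (k : ℕ) : ℕ := max 1 (Nat.clog 2 k)

open Classical in
/-- The last index `j ≤ d` such that `p j` has an informed in-neighbour. -/
noncomputable def front (G : Digraph V) (p : ℕ → V) (d : ℕ) (m : V → Option M) : ℕ :=
  ((Finset.range (d + 1)).filter fun j => ∃ w, (m w).isSome ∧ G.Adj w (p j)).sup id

theorem le_front (G : Digraph V) (p : ℕ → V) (d : ℕ) (m : V → Option M) (j : ℕ) (hj : j ≤ d)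
    (w : V) (hw : (m w).isSome) (ha : G.Adj w (p j)) : j ≤ front G p d m := by
  classical
  have hmem : j ∈ (Finset.range (d + 1)).filter fun j => ∃ w, (m w).isSome ∧ G.Adj w (p j) := by
    simp only [Finset.mem_filter, Finset.mem_range]
    exact ⟨by omega, w, hw, ha⟩
  exact Finset.le_sup (f := id) hmem

theorem front_le (G : Digraph V) (p : ℕ → V) (d : ℕ) (m : V → Option M) :
    front G p d m ≤ d := by
  classical
  unfold front
  refine Finset.sup_le fun j hj => ?_
  simp only [Finset.mem_filter, Finset.mem_range] at hj
  simp only [id]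
  omega

theorem front_mono (G : Digraph V) (p : ℕ → V) (d : ℕ) (m m' : V → Option M)
    (h : ∀ w, (m w).isSome → (m' w).isSome) : front G p d m ≤ front G p d m' := by
  classical
  unfold front
  refine Finset.sup_mono fun j hj => ?_
  simp only [Finset.mem_filter, Finset.mem_range] at hj ⊢
  obtain ⟨h1, w, hw, ha⟩ := hj
  exact ⟨h1, w, h w hw, ha⟩

theorem exists_adj_front (G : Digraph V) (p : ℕ → V) (d : ℕ) (m : V → Option M) (hd : 1 ≤ d)
    (h0 : (m (p 0)).isSome) (hp : G.Adj (p 0) (p 1)) :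
    ∃ w, G.Adj w (p (front G p d m)) ∧ (m w).isSome := by
  classical
  have hne : ((Finset.range (d + 1)).filter fun j => ∃ w, (m w).isSome ∧ G.Adj w (p j)).Nonempty :=
    ⟨1, by simp only [Finset.mem_filter, Finset.mem_range]; exact ⟨by omega, p 0, h0, hp⟩⟩
  obtain ⟨j, hj, he⟩ := Finset.exists_mem_eq_sup _ hne id
  simp only [Finset.mem_filter, Finset.mem_range] at hj
  obtain ⟨-, w, hw, ha⟩ := hj
  refine ⟨w, ?_, hw⟩
  have : front G p d m = j := he
  rw [this]; exact ha

/-- The front moves on as soon as the node at the front is informed. -/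
theorem eq_none_front (G : Digraph V) (p : ℕ → V) (d : ℕ) (m : V → Option M)
    (hp : ∀ i < d, G.Adj (p i) (p (i + 1))) (hd : m (p d) = none) :
    m (p (front G p d m)) = none := by
  by_contra hne
  have hs : (m (p (front G p d m))).isSome := Option.isSome_iff_ne_none.2 hne
  rcases (front_le G p d m).lt_or_eq with hlt | heq
  · have := le_front G p d m _ hlt _ hs (hp _ hlt)
    omega
  · rw [heq] at hne; exact hne hd

end Path

/-- The inequality behind the choice of the potential. -/
theorem exp_potential_le (x : ℝ) (h0 : 0 ≤ x) (h1 : x ≤ 1 / 10) :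
    1 + 0.82 * (Real.exp (8 * x) - 1) ≤ Real.exp (7 * x) := by
  -- After division by `exp (7 x)` the claim is `0.18 exp (-7 x) + 0.82 exp x ≤ 1`. Its left side is
  -- convex and equals 1 at `x = 0`, so it suffices to check `x = 1 / 10`; `hconv` is the chord
  -- bound on `[0, 1 / 10]`.
  have hconv : ∀ a : ℝ, Real.exp (10 * x * a) ≤ 1 - 10 * x + 10 * x * Real.exp a := by
    intro a
    have := convexOn_exp.2 (Set.mem_univ (0 : ℝ)) (Set.mem_univ a)
      (show (0 : ℝ) ≤ 1 - 10 * x by linarith) (show (0 : ℝ) ≤ 10 * x by linarith) (by ring)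
    simpa using this
  have ha : Real.exp (1 / 10) ≤ 1.1053 := by
    refine le_of_pow_le_pow_left₀ (n := 10) (by norm_num) (by norm_num) ?_
    rw [← Real.exp_nat_mul]
    have := Real.exp_one_lt_d9
    norm_num at this ⊢
    linarith
  have hb : Real.exp (-(7 / 10)) ≤ 0.52 := by
    refine le_of_pow_le_pow_left₀ (n := 10) (by norm_num) (by norm_num) ?_
    rw [← Real.exp_nat_mul, show ((10 : ℕ) : ℝ) * (-(7 / 10)) = (7 : ℕ) * (-1) by norm_num,
      Real.exp_nat_mul]
    have h2 := Real.exp_neg_one_lt_d9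
    calc Real.exp (-1) ^ 7 ≤ (0.37 : ℝ) ^ 7 :=
          pow_le_pow_left₀ (Real.exp_pos _).le (by linarith) 7
      _ ≤ _ := by norm_num
  have c1 := hconv (1 / 10)
  have c2 := hconv (-(7 / 10))
  rw [show 10 * x * (1 / 10) = x by ring] at c1
  rw [show 10 * x * (-(7 / 10)) = -(7 * x) by ring] at c2
  have key : 0.18 * Real.exp (-(7 * x)) + 0.82 * Real.exp x ≤ 1 := by nlinarith
  have hpos := Real.exp_pos (7 * x)
  have e1 : Real.exp (7 * x) * Real.exp (-(7 * x)) = 1 := by rw [← Real.exp_add]; simp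
  have e2 : Real.exp (7 * x) * Real.exp x = Real.exp (8 * x) := by
    rw [← Real.exp_add]; congr 1; ring
  nlinarith [mul_le_mul_of_nonneg_left key hpos.le]

/-! ### An exponential supermartingale for the front -/

section Potential

variable {V : Type u} {M : Type} [Fintype V]

/-- Data for the analysis of a broadcast along the path `p 0, …, p d`: if the front is at `j`, then
at least one in `gap j` rounds has a sufficient height. -/
structure PathSchedule (G : Digraph V) (h : ℕ → ℕ) (l : ℕ) (p : ℕ → V) (d : ℕ) (θ : ℝ) where
  adj : ∀ i < d, G.Adj (p i) (p (i + 1))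
  gap : ℕ → ℕ
  exists_height : ∀ j q, ∃ r < gap j, neededHeight (lastInNeighbors G p d j).card ≤ h (q + r)
  height_le : ∀ q, h q ≤ l
  rate_nonneg : 0 ≤ θ
  rate_mul_gap : ∀ j, θ * gap j ≤ 1 / 10

namespace PathSchedule

variable {G : Digraph V} {h : ℕ → ℕ} {l : ℕ} {p : ℕ → V} {d : ℕ} {θ : ℝ}

theorem exists_wait (S : PathSchedule G h l p d θ) (j q : ℕ) :
    ∃ r, neededHeight (lastInNeighbors G p d j).card ≤ h (q + r) :=
  let ⟨r, _, hr⟩ := S.exists_height j q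
  ⟨r, hr⟩

open Classical in
/-- The number of rounds until the next one of sufficient height for index `j`. -/
noncomputable def wait (S : PathSchedule G h l p d θ) (j q : ℕ) : ℕ := Nat.find (S.exists_wait j q)

theorem wait_lt (S : PathSchedule G h l p d θ) (j q : ℕ) : S.wait j q < S.gap j := by
  classical
  obtain ⟨r, hr, hh⟩ := S.exists_height j q
  exact lt_of_le_of_lt (Nat.find_min' _ hh) hr

theorem height_of_wait_eq_zero (S : PathSchedule G h l p d θ) (j q : ℕ) (h0 : S.wait j q = 0) :
    neededHeight (lastInNeighbors G p d j).card ≤ h q := by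
  classical
  have := Nat.find_spec (S.exists_wait j q)
  rw [show Nat.find (S.exists_wait j q) = 0 from h0] at this
  exact this

theorem wait_succ_lt (S : PathSchedule G h l p d θ) (j q : ℕ) (h0 : S.wait j q ≠ 0) :
    S.wait j (q + 1) + 1 ≤ S.wait j q := by
  classical
  have hspec : neededHeight (lastInNeighbors G p d j).card ≤ h (q + S.wait j q) :=
    Nat.find_spec (S.exists_wait j q)
  have : S.wait j (q + 1) ≤ S.wait j q - 1 := by
    refine Nat.find_min' _ ?_
    rw [show q + 1 + (S.wait j q - 1) = q + S.wait j q by omega]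
    exact hspec
  omega

/-- The total gap of the indices after `j`. -/
def rest (S : PathSchedule G h l p d θ) (j : ℕ) : ℕ := ∑ i ∈ Finset.Ioc j d, S.gap i

theorem gap_add_rest_le (S : PathSchedule G h l p d θ) (j j' : ℕ) (hj : j < j') (hd : j' ≤ d) :
    S.gap j' + S.rest j' ≤ S.rest j := by
  unfold rest
  rw [← Finset.sum_insert (f := S.gap) (a := j') (s := Finset.Ioc j' d) (by simp)]
  refine Finset.sum_le_sum_of_subset fun i hi => ?_
  simp only [Finset.mem_insert, Finset.mem_Ioc] at hi ⊢
  omega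

/-- The potential of front `j` at the beginning of round `q`. -/
noncomputable def weight (S : PathSchedule G h l p d θ) (q j : ℕ) : ℝ :=
  Real.exp (θ * (q + 7 * S.gap j + S.wait j q + 8 * S.rest j))

/-- The potential after the node at front `j` is informed in round `q`. -/
noncomputable def nextWeight (S : PathSchedule G h l p d θ) (q j : ℕ) : ℝ :=
  Real.exp (θ * (q + 8 * S.rest j))

/-- The gap of the new front `j'` was part of `rest j`, where it counts 8 times. This pays 7 for
`gap j'` and one more for the elapsed round together with the wait, since `wait + 1 ≤ gap`. -/
theorem weight_succ_le_nextWeight (S : PathSchedule G h l p d θ) (q j j' : ℕ) (hj : j < j')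
    (hd : j' ≤ d) : S.weight (q + 1) j' ≤ S.nextWeight q j := by
  apply Real.exp_le_exp.2
  refine mul_le_mul_of_nonneg_left ?_ S.rate_nonneg
  have h1 : ((S.gap j' + S.rest j' : ℕ) : ℝ) ≤ S.rest j := by
    exact_mod_cast S.gap_add_rest_le j j' hj hd
  have h2 : ((S.wait j' (q + 1) + 1 : ℕ) : ℝ) ≤ S.gap j' := by
    exact_mod_cast S.wait_lt j' (q + 1)
  push_cast at h1 h2 ⊢
  linarith

theorem nextWeight_le_weight (S : PathSchedule G h l p d θ) (q j : ℕ) :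
    S.nextWeight q j ≤ S.weight q j := by
  apply Real.exp_le_exp.2
  refine mul_le_mul_of_nonneg_left ?_ S.rate_nonneg
  have h1 : (0 : ℝ) ≤ S.gap j := by positivity
  have h2 : (0 : ℝ) ≤ S.wait j q := by positivity
  linarith

/-- While the height is insufficient, the round count grows by one and the wait shrinks by at least
one. -/
theorem weight_succ_le_weight (S : PathSchedule G h l p d θ) (q j : ℕ) (h0 : S.wait j q ≠ 0) :
    S.weight (q + 1) j ≤ S.weight q j := by
  apply Real.exp_le_exp.2
  refine mul_le_mul_of_nonneg_left ?_ S.rate_nonneg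
  have h1 : ((S.wait j (q + 1) + 1 : ℕ) : ℝ) ≤ S.wait j q := by
    exact_mod_cast S.wait_succ_lt j q h0
  push_cast at h1 ⊢
  linarith

/-- The price of a failed attempt: the wait is reset, but elapsed round and new wait together cost
at most one gap, on top of the seven already in the weight. -/
theorem weight_succ_le_mul (S : PathSchedule G h l p d θ) (q j : ℕ) :
    S.weight (q + 1) j ≤ S.nextWeight q j * Real.exp (8 * (θ * S.gap j)) := by
  rw [nextWeight, ← Real.exp_add]
  apply Real.exp_le_exp.2
  have h2 : ((S.wait j (q + 1) + 1 : ℕ) : ℝ) ≤ S.gap j := by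
    exact_mod_cast S.wait_lt j (q + 1)
  have h3 := mul_le_mul_of_nonneg_left h2 S.rate_nonneg
  push_cast at h3 ⊢
  linarith

theorem mul_le_weight (S : PathSchedule G h l p d θ) (q j : ℕ) :
    S.nextWeight q j * Real.exp (7 * (θ * S.gap j)) ≤ S.weight q j := by
  rw [nextWeight, ← Real.exp_add]
  apply Real.exp_le_exp.2
  have h3 : 0 ≤ θ * S.wait j q := mul_nonneg S.rate_nonneg (by positivity)
  linarith

open Classical in
/-- The potential of a state of the broadcast at the beginning of round `q`. -/
noncomputable def potential (S : PathSchedule G h l p d θ) (q : ℕ) (m : V → Option M) : ℝ≥0∞ :=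
  if m (p 0) = none then ⊤
  else if m (p d) = none then ENNReal.ofReal (S.weight q (front G p d m)) else 0

/-- An informed `p j` forces the front past `j`, unless the end of the path is reached. If `p j`
stays silent, the front may nevertheless move through other nodes, hence the maximum. -/
theorem potential_step_le (S : PathSchedule G h l p d θ) (q : ℕ) (m : V → Option M)
    (coins : DecayCoins V l) (part : V → Bool) (hpart : ∀ v, part v = true)
    (h0 : m (p 0) ≠ none) :
    S.potential (q + 1) (broadcastStep G h part q m coins) ≤
      if decay G (h q) m coins (p (front G p d m)) = none then
        max (ENNReal.ofReal (S.nextWeight q (front G p d m)))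
          (ENNReal.ofReal (S.weight (q + 1) (front G p d m)))
      else ENNReal.ofReal (S.nextWeight q (front G p d m)) := by
  have hmono := broadcastStep_isSome G h part q m coins
  have h0' : broadcastStep G h part q m coins (p 0) ≠ none :=
    Option.isSome_iff_ne_none.1 (hmono _ (Option.isSome_iff_ne_none.2 h0))
  rw [potential, if_neg h0']
  split_ifs with hd' hdec hdec
  · rcases (front_mono G p d m _ hmono).lt_or_eq with hlt | heq
    · exact le_max_of_le_left (ENNReal.ofReal_le_ofReal
        (S.weight_succ_le_nextWeight q _ _ hlt (front_le ..)))
    · rw [← heq]; exact le_max_right _ _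
  · rcases (front_mono G p d m _ hmono).lt_or_eq with hlt | heq
    · exact ENNReal.ofReal_le_ofReal (S.weight_succ_le_nextWeight q _ _ hlt (front_le ..))
    · exfalso
      have h1 := eq_none_front G p d _ S.adj hd'
      rw [← heq, broadcastStep, Option.or_eq_none_iff, if_pos (hpart _)] at h1
      exact hdec h1.2
  · exact zero_le
  · exact zero_le

/-- In a waiting round the inequality holds for every outcome. In a round of sufficient height,
failure has probability at most 0.82, and the average is controlled by `exp_potential_le` with `x =
θ * gap j`. -/
theorem lintegral_potential_le (S : PathSchedule G h l p d θ) (q : ℕ) (m : V → Option M)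
    (part : V → Bool) (hpart : ∀ v, part v = true) :
    ∫⁻ coins, S.potential (q + 1) (broadcastStep G h part q m coins) ∂(decayLaw V l) ≤
      S.potential q m := by
  classical
  by_cases h0 : m (p 0) = none
  -- The value `⊤` for a silent start of the path makes the inequality vacuous there; no broadcast
  -- from the source visits such a state.
  · rw [potential, if_pos h0]; exact le_top
  by_cases hd : m (p d) = none
  swap
  · have : ∀ coins : DecayCoins V l,
        S.potential (q + 1) (broadcastStep G h part q m coins) = 0 := by
      intro coins
      have hmono := broadcastStep_isSome G h part q m coins
      rw [potential, if_neg, if_neg]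
      · exact Option.isSome_iff_ne_none.1 (hmono _ (Option.isSome_iff_ne_none.2 hd))
      · exact Option.isSome_iff_ne_none.1 (hmono _ (Option.isSome_iff_ne_none.2 h0))
    simp [this]
  set j := front G p d m with hj
  have hstep := fun coins => S.potential_step_le q m coins part hpart h0
  rw [← hj] at hstep
  have hrhs : S.potential q m = ENNReal.ofReal (S.weight q j) := by
    rw [potential, if_neg h0, if_pos hd]
  rw [hrhs]
  by_cases hw : S.wait j q = 0
  · have hd1 : 1 ≤ d := by
      rcases Nat.eq_zero_or_pos d with h | h
      · rw [h] at hd; exact absurd hd h0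
      · exact h
    have hheight := S.height_of_wait_eq_zero j q hw
    have hfail := decayLaw_decay_eq_none_le (l := l) G (h q) m (p j)
      (eq_none_front G p d m S.adj hd)
      (exists_adj_front G p d m hd1 (Option.isSome_iff_ne_none.2 h0) (S.adj 0 (by omega)))
      (lastInNeighbors G p d j) (by
        intro w hwa hws
        simp only [lastInNeighbors, Finset.mem_filter, Finset.mem_univ, true_and]
        refine ⟨hwa, fun i hji hid ha => ?_⟩
        have := le_front G p d m i hid w hws ha
        omega)
      ((Nat.le_pow_clog (by norm_num) _).trans
        (Nat.pow_le_pow_right (by norm_num) ((le_max_right 1 _).trans hheight)))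
      ((le_max_left 1 _).trans hheight) (S.height_le q)
    set x := θ * S.gap j with hx
    set B := S.nextWeight q j with hB
    have hBpos : 0 < B := Real.exp_pos _
    have hx0 : 0 ≤ x := mul_nonneg S.rate_nonneg (by positivity)
    have hx1 : x ≤ 1 / 10 := S.rate_mul_gap j
    have he8 : 1 ≤ Real.exp (8 * x) := Real.one_le_exp (by linarith)
    calc ∫⁻ coins, S.potential (q + 1) (broadcastStep G h part q m coins) ∂(decayLaw V l)
        ≤ ∫⁻ coins, (ENNReal.ofReal B + {coins | decay G (h q) m coins (p j) = none}.indicator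
            (fun _ => ENNReal.ofReal (B * (Real.exp (8 * x) - 1))) coins) ∂(decayLaw V l) := by
          refine lintegral_mono fun coins => (hstep coins).trans ?_
          rw [Set.indicator_apply]
          simp only [Set.mem_ofPred_eq]
          split_ifs with hdec
          · rw [← ENNReal.ofReal_add hBpos.le (mul_nonneg hBpos.le (by linarith))]
            refine max_le (ENNReal.ofReal_le_ofReal ?_) (ENNReal.ofReal_le_ofReal ?_)
            · nlinarith
            · refine (S.weight_succ_le_mul q j).trans (le_of_eq ?_)
              ring
          · exact le_self_add
      _ = ENNReal.ofReal B + ENNReal.ofReal (B * (Real.exp (8 * x) - 1)) *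
            decayLaw V l {coins | decay G (h q) m coins (p j) = none} := by
          rw [lintegral_add_left measurable_const, lintegral_indicator_const
            MeasurableSet.of_discrete]
          simp
      _ ≤ ENNReal.ofReal B + ENNReal.ofReal (B * (Real.exp (8 * x) - 1)) *
            ENNReal.ofReal 0.82 := by gcongr
      _ = ENNReal.ofReal (B * (1 + 0.82 * (Real.exp (8 * x) - 1))) := by
          rw [← ENNReal.ofReal_mul (mul_nonneg hBpos.le (by linarith)),
            ← ENNReal.ofReal_add hBpos.le
              (mul_nonneg (mul_nonneg hBpos.le (by linarith)) (by norm_num))]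
          congr 1; ring
      _ ≤ ENNReal.ofReal (S.weight q j) := by
          apply ENNReal.ofReal_le_ofReal
          refine le_trans ?_ (S.mul_le_weight q j)
          exact mul_le_mul_of_nonneg_left (exp_potential_le x hx0 hx1) hBpos.le
  · calc ∫⁻ coins, S.potential (q + 1) (broadcastStep G h part q m coins) ∂(decayLaw V l)
        ≤ ∫⁻ _, ENNReal.ofReal (S.weight q j) ∂(decayLaw V l) := by
          refine lintegral_mono fun coins => (hstep coins).trans ?_
          have h1 := ENNReal.ofReal_le_ofReal (S.nextWeight_le_weight q j)
          have h2 := ENNReal.ofReal_le_ofReal (S.weight_succ_le_weight q j hw)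
          split_ifs
          · exact max_le h1 h2
          · exact h1
      _ = _ := by simp

/-- The probability that a broadcast does not reach the end of a path whose first node is a
source. -/
theorem measure_multiBroadcast_eq_none_le (S : PathSchedule G h l p d θ) (f : V → Option M)
    (part : V → Bool) (hpart : ∀ v, part v = true) (h0 : f (p 0) ≠ none) (Q : ℕ) :
    (Measure.pi fun _ : Fin Q => decayLaw V l)
        {coins | multiBroadcast G h part f coins (p d) = none} ≤
      ENNReal.ofReal (Real.exp (θ * (8 * S.rest 0 - Q))) := by
  classical
  have hfold := lintegral_foldl_le (decayLaw V l)
    (fun q m coins => broadcastStep G h part q m coins) (fun q m => S.potential (M := M) q m)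
    (fun q m => S.lintegral_potential_le q m part hpart) Q 0 f
  simp only [← multiBroadcast_eq_foldl] at hfold
  have hinit : S.potential 0 f ≤ ENNReal.ofReal (Real.exp (θ * (8 * S.rest 0))) := by
    rw [potential, if_neg h0]
    split_ifs with hd
    · apply ENNReal.ofReal_le_ofReal
      have hd1 : 1 ≤ d := by
        rcases Nat.eq_zero_or_pos d with h | h
        · rw [h] at hd; exact absurd hd h0
        · exact h
      have hf1 : 1 ≤ front G p d f :=
        le_front G p d f 1 hd1 (p 0) (Option.isSome_iff_ne_none.2 h0) (S.adj 0 (by omega))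
      apply Real.exp_le_exp.2
      refine mul_le_mul_of_nonneg_left ?_ S.rate_nonneg
      have h1 : ((S.gap (front G p d f) + S.rest (front G p d f) : ℕ) : ℝ) ≤ S.rest 0 := by
        exact_mod_cast S.gap_add_rest_le 0 _ hf1 (front_le ..)
      have h2 : ((S.wait (front G p d f) 0 : ℕ) : ℝ) ≤ S.gap (front G p d f) := by
        exact_mod_cast (S.wait_lt _ 0).le
      push_cast at h1 h2 ⊢
      linarith
    · exact zero_le
  -- Markov's inequality: if `p d` is still silent after `Q` rounds, the potential is at least `exp
  -- (θ * Q)`.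
  have hlow : ENNReal.ofReal (Real.exp (θ * Q)) * (Measure.pi fun _ : Fin Q => decayLaw V l)
        {coins | multiBroadcast G h part f coins (p d) = none} ≤
      ∫⁻ coins, S.potential (0 + Q) (multiBroadcast G h part f coins)
        ∂(Measure.pi fun _ : Fin Q => decayLaw V l) := by
    rw [← lintegral_indicator_const MeasurableSet.of_discrete]
    refine lintegral_mono fun coins => ?_
    rw [Set.indicator_apply]
    simp only [Set.mem_ofPred_eq]
    split_ifs with hd
    · rw [potential]
      split_ifs
      · exact le_top
      · apply ENNReal.ofReal_le_ofReal
        apply Real.exp_le_exp.2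
        refine mul_le_mul_of_nonneg_left ?_ S.rate_nonneg
        rw [zero_add]
        have : (0 : ℝ) ≤ 7 * S.gap (front G p d (multiBroadcast G h part f coins)) +
          S.wait (front G p d (multiBroadcast G h part f coins)) Q +
          8 * S.rest (front G p d (multiBroadcast G h part f coins)) := by positivity
        linarith
    · exact zero_le
  have hmul := hlow.trans (hfold.trans hinit)
  rw [mul_sub, Real.exp_sub, ENNReal.ofReal_div_of_pos (Real.exp_pos _)]
  rw [ENNReal.le_div_iff_mul_le (by left; simp [Real.exp_pos]) (by left; simp), mul_comm]
  exact hmul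

end PathSchedule

end Potential

/-! ### The broadcast schedule -/

theorem exists_path_le_eccentricity {V : Type u} [Fintype V] (G : Digraph V)
    (hG : StronglyConnected G) (u v : V) :
    ∃ (p : ℕ → V) (d : ℕ), p 0 = u ∧ p d = v ∧ (∀ i < d, G.Adj (p i) (p (i + 1))) ∧
      d ≤ eccentricity G := by
  -- Reachability is needed here because `sInf ∅ = 0`: only for a nonempty set is the infimum the
  -- length of an actual walk.
  have hne : {k : ℕ | ∃ p : ℕ → V, p 0 = u ∧ p k = v ∧
      ∀ i < k, G.Adj (p i) (p (i + 1))}.Nonempty := by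
    induction hG u v with
    | refl => exact ⟨0, fun _ => u, rfl, rfl, fun i hi => absurd hi (Nat.not_lt_zero i)⟩
    | @tail b w _ hbw ih =>
      obtain ⟨k, p, h0, hk, hp⟩ := ih
      refine ⟨k + 1, fun i => if i ≤ k then p i else w, by simp [h0], by simp, fun i hi => ?_⟩
      rcases Nat.lt_succ_iff_lt_or_eq.1 hi with hlt | heq
      · simpa [hlt.le, Nat.succ_le_of_lt hlt] using hp i hlt
      · subst heq; simpa [hk] using hbw
  obtain ⟨p, h0, hd, hp⟩ := Nat.sInf_mem hne
  refine ⟨p, _, h0, hd, hp, ?_⟩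
  have h1 : hopDist G u v ≤ Finset.univ.sup fun v : V => hopDist G u v :=
    Finset.le_sup (f := fun v => hopDist G u v) (Finset.mem_univ v)
  have h2 : (Finset.univ.sup fun v : V => hopDist G u v) ≤ eccentricity G :=
    Finset.le_sup (f := fun u => Finset.univ.sup fun v : V => hopDist G u v) (Finset.mem_univ u)
  exact h1.trans h2

/-- A node has at most one last out-neighbour index on the path, so the sets are disjoint. -/
theorem sum_card_lastInNeighbors_le {V : Type u} [Fintype V] (G : Digraph V) (p : ℕ → V)
    (d : ℕ) : ∑ j ∈ Finset.Ioc 0 d, (lastInNeighbors G p d j).card ≤ Fintype.card V := by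
  classical
  rw [← Finset.card_biUnion]
  · exact Finset.card_le_univ _
  · have key : ∀ i j, j ≤ d → i < j →
        Disjoint (lastInNeighbors G p d i) (lastInNeighbors G p d j) := by
      intro i j hj hij
      rw [Finset.disjoint_left]
      intro w hi hj'
      simp only [lastInNeighbors, Finset.mem_filter, Finset.mem_univ, true_and] at hi hj'
      exact hi.2 j hij hj hj'.1
    intro i hi j hj hij
    rw [Finset.mem_coe, Finset.mem_Ioc] at hi hj
    rcases lt_or_gt_of_ne hij with h | h
    · exact key i j hj.2 h
    · exact (key j i hi.2 h).symm

theorem one_le_logSize {n : ℕ} (hn : 2 ≤ n) : 1 ≤ logSize n := Nat.clog_pos (by norm_num) hn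

theorem le_two_pow_logSize (n : ℕ) : n ≤ 2 ^ logSize n := Nat.le_pow_clog (by norm_num) n

theorem lt_mul_two_pow_logRatio (n D : ℕ) (hD : 0 < D) : n < D * 2 ^ logRatio n D := by
  have h := Nat.lt_pow_succ_log_self (b := 2) (by norm_num) (n / D)
  rw [Nat.div_lt_iff_lt_mul hD] at h
  rw [mul_comm]; exact h

theorem roundHeight_le (n D q : ℕ) : roundHeight n D q ≤ logSize n := by
  unfold roundHeight; split_ifs
  · exact le_rfl
  · exact min_le_left _ _

/-- At least one in so many rounds has height at least `t`. -/
def heightGap (n D t : ℕ) : ℕ := min (fullPeriod n D) (2 ^ (t - logRatio n D))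

/-- There are two sources of high rounds: every `fullPeriod` rounds a full one, and among `2 ^ a`
consecutive rounds one with `2 ^ a ∣ q + 1`, where `a = t - logRatio n D`. -/
theorem exists_le_roundHeight (n D t : ℕ) (ht : t ≤ logSize n) (q : ℕ) :
    ∃ r < heightGap n D t, t ≤ roundHeight n D (q + r) := by
  have hg : 0 < fullPeriod n D := Nat.succ_pos _
  rcases le_total (fullPeriod n D) (2 ^ (t - logRatio n D)) with h | h
  · rw [heightGap, min_eq_left h]
    refine ⟨(fullPeriod n D - q % fullPeriod n D) % fullPeriod n D, Nat.mod_lt _ hg, ?_⟩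
    have hz : (q + (fullPeriod n D - q % fullPeriod n D) % fullPeriod n D) % fullPeriod n D = 0 := by
      rw [Nat.add_mod, Nat.mod_mod, ← Nat.add_mod]
      have h1 := Nat.mod_lt q hg
      have h2 := Nat.div_add_mod q (fullPeriod n D)
      have : q + (fullPeriod n D - q % fullPeriod n D) =
          fullPeriod n D * (q / fullPeriod n D + 1) := by
        rw [mul_add, mul_one]; omega
      rw [this, Nat.mul_mod_right]
    rw [roundHeight, if_pos hz]
    exact ht
  · rw [heightGap, min_eq_right h]
    set a := t - logRatio n D with ha
    have hpos : 0 < 2 ^ a := by positivity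
    have h1 := Nat.mod_lt q hpos
    refine ⟨2 ^ a - 1 - q % 2 ^ a, by omega, ?_⟩
    rw [roundHeight]
    split_ifs
    · exact ht
    · refine le_min ht ?_
      have hdvd : 2 ^ a ∣ q + (2 ^ a - 1 - q % 2 ^ a) + 1 := by
        have h2 := Nat.div_add_mod q (2 ^ a)
        refine ⟨q / 2 ^ a + 1, ?_⟩
        rw [mul_add, mul_one]; omega
      have := (padicValNat_dvd_iff_le (p := 2) (by omega)).1 hdvd
      omega

theorem heightGap_le (n D t : ℕ) : heightGap n D t ≤ fullPeriod n D := min_le_left _ _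

/-- A height up to `λ` is available in every round, giving the term `n`. Beyond that the gap is at
most `2 ^ (clog k - λ)`, and `n < D * 2 ^ λ` together with `2 ^ clog k ≤ 2 k` gives `2 D k`. -/
theorem mul_heightGap_neededHeight_le (n D k : ℕ) (hD : 0 < D) :
    n * heightGap n D (neededHeight k) ≤ n + 2 * D * k := by
  refine (Nat.mul_le_mul_left n (min_le_right _ _)).trans ?_
  rcases le_or_gt (neededHeight k) (logRatio n D) with h | h
  · rw [Nat.sub_eq_zero_of_le h]; simp
  · have hr : 1 ≤ logRatio n D := Nat.succ_pos _
    have hc : neededHeight k = Nat.clog 2 k := by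
      unfold neededHeight at *; omega
    have hk : 1 < k := by
      by_contra hk
      rw [hc, Nat.clog_of_right_le_one (by omega)] at h
      omega
    have h1 : 2 ^ Nat.clog 2 k ≤ 2 * k := by
      have h2 := Nat.pow_pred_clog_lt_self (b := 2) (by norm_num) hk
      have h3 : 1 ≤ Nat.clog 2 k := Nat.clog_pos (by norm_num) hk
      rw [← Nat.sub_add_cancel h3, pow_succ]
      rw [Nat.pred_eq_sub_one] at h2
      omega
    have h4 := lt_mul_two_pow_logRatio n D hD
    rw [hc] at h ⊢
    calc n * 2 ^ (Nat.clog 2 k - logRatio n D)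
        ≤ D * 2 ^ logRatio n D * 2 ^ (Nat.clog 2 k - logRatio n D) :=
          Nat.mul_le_mul_right _ h4.le
      _ = D * 2 ^ Nat.clog 2 k := by
          rw [mul_assoc, ← pow_add, Nat.add_sub_cancel' h.le]
      _ ≤ D * (2 * k) := Nat.mul_le_mul_left _ h1
      _ ≤ n + 2 * D * k := by rw [mul_comm 2 D, mul_assoc]; omega

theorem sum_heightGap_le {V : Type u} [Fintype V] (G : Digraph V) (p : ℕ → V) (d n D : ℕ)
    (hn : n = Fintype.card V) (hn2 : 2 ≤ n) (hd : d ≤ D) :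
    ∑ j ∈ Finset.Ioc 0 d, heightGap n D (neededHeight (lastInNeighbors G p d j).card) ≤
      3 * D := by
  rcases Nat.eq_zero_or_pos D with h0 | hD
  · have : d = 0 := by omega
    simp [this]
  refine Nat.le_of_mul_le_mul_left (c := n) ?_ (by omega)
  rw [Finset.mul_sum]
  calc _ ≤ ∑ j ∈ Finset.Ioc 0 d, (n + 2 * D * (lastInNeighbors G p d j).card) :=
        Finset.sum_le_sum fun j _ => mul_heightGap_neededHeight_le n D _ hD
    _ = d * n + 2 * D * ∑ j ∈ Finset.Ioc 0 d, (lastInNeighbors G p d j).card := by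
        rw [Finset.sum_add_distrib, Finset.mul_sum]; simp
    _ ≤ D * n + 2 * D * n := by
        have := sum_card_lastInNeighbors_le G p d
        rw [← hn] at this
        gcongr
    _ = n * (3 * D) := by ring

/-- The schedule of the algorithm, for a path of length at most `D`. -/
noncomputable def pathSchedule {V : Type u} [Fintype V] (G : Digraph V) (p : ℕ → V) (d n D : ℕ)
    (hn : n = Fintype.card V) (hn2 : 2 ≤ n) (hp : ∀ i < d, G.Adj (p i) (p (i + 1))) :
    PathSchedule G (roundHeight n D) (logSize n) p d (1 / (10 * fullPeriod n D)) where
  adj := hp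
  gap j := heightGap n D (neededHeight (lastInNeighbors G p d j).card)
  exists_height j q := by
    refine exists_le_roundHeight n D _ (max_le (one_le_logSize hn2) ?_) q
    refine Nat.clog_mono_right 2 ?_
    rw [hn]; exact Finset.card_le_univ _
  height_le := roundHeight_le n D
  rate_nonneg := by positivity
  rate_mul_gap j := by
    have hg : (0 : ℝ) < fullPeriod n D := by exact_mod_cast Nat.succ_pos _
    have h : (heightGap n D (neededHeight (lastInNeighbors G p d j).card) : ℝ) ≤
      fullPeriod n D := by exact_mod_cast heightGap_le n D _
    rw [div_mul_eq_mul_div, one_mul, div_le_div_iff₀ (by positivity) (by norm_num)]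
    linarith

/-- A broadcast with at least one source reaches all nodes with high probability. -/
theorem measure_exists_multiBroadcast_eq_none_le {V : Type u} [Fintype V] {M : Type}
    (G : Digraph V) (hG : StronglyConnected G) (n D K : ℕ) (hn : n = Fintype.card V)
    (hn2 : 2 ≤ n) (hD : D = eccentricity G) (hK : 24 ≤ K) (f : V → Option M) (part : V → Bool)
    (hpart : ∀ v, part v = true) (hf : ∃ v, f v ≠ none) :
    (Measure.pi fun _ : Fin (numRounds K n D) => decayLaw V (logSize n))
        {coins | ∃ v, multiBroadcast G (roundHeight n D) part f coins v = none} ≤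
      ENNReal.ofReal (n * Real.exp (-(K * logSize n / 10))) := by
  obtain ⟨s, hs⟩ := hf
  have hset : {coins : Fin (numRounds K n D) → DecayCoins V (logSize n) |
      ∃ v, multiBroadcast G (roundHeight n D) part f coins v = none} =
      ⋃ v ∈ Finset.univ, {coins | multiBroadcast G (roundHeight n D) part f coins v = none} := by
    ext; simp
  rw [hset]
  refine (measure_biUnion_finset_le _ _).trans ?_
  rw [ENNReal.ofReal_mul (by positivity), ENNReal.ofReal_natCast, ← nsmul_eq_mul]
  refine (Finset.sum_le_card_nsmul _ _ _ fun v _ => ?_).trans_eq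
    (by rw [Finset.card_univ, ← hn])
  obtain ⟨p, d, h0, hd, hp, hdD⟩ := exists_path_le_eccentricity G hG s v
  rw [← hD] at hdD
  have h := (pathSchedule G p d n D hn hn2 hp).measure_multiBroadcast_eq_none_le f part hpart
    (by rw [h0]; exact hs) (numRounds K n D)
  rw [hd] at h
  refine h.trans (ENNReal.ofReal_le_ofReal (Real.exp_le_exp.2 ?_))
  have hsum : ((pathSchedule G p d n D hn hn2 hp).rest 0 : ℝ) ≤ 3 * D := by
    exact_mod_cast sum_heightGap_le G p d n D hn hn2 hdD
  have hg : (0 : ℝ) < fullPeriod n D := by exact_mod_cast Nat.succ_pos _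
  have hK' : (24 : ℝ) ≤ K := by exact_mod_cast hK
  have hD0 : (0 : ℝ) ≤ D := by positivity
  -- The `8 * 3 D = 24 D` of the potential is absorbed by `K D`; the remaining `K ℓ g`, divided by
  -- `10 g`, yields the exponent.
  rw [numRounds, div_mul_eq_mul_div, one_mul, div_le_iff₀ (by positivity)]
  push_cast
  nlinarith

/-- The number of rounds per broadcast is governed by this constant. -/
def roundFactor (c : ℕ) : ℕ := 10 * (3 * c + 8)

/-- With `exp 1 ≥ 2` and `2 ^ ℓ ≥ n`, the exponent `3 c + 8` splits into `3 c + 1` powers of `n`,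
one of them for the union bound over nodes, and seven factors of at least 2, which make 128. -/
theorem mul_exp_roundFactor_le (c n : ℕ) (hn2 : 2 ≤ n) :
    n * Real.exp (-(roundFactor c * logSize n / 10)) ≤ ((n : ℝ) ^ (3 * c))⁻¹ / 128 := by
  have hl := one_le_logSize hn2
  have hn0 : (0 : ℝ) < n := by positivity
  have h2 : ((n : ℝ) ^ (3 * c + 1)) * 128 ≤ 2 ^ ((3 * c + 8) * logSize n) := by
    have h3 : n ^ (3 * c + 1) * 2 ^ 7 ≤ 2 ^ ((3 * c + 8) * logSize n) := by
      calc n ^ (3 * c + 1) * 2 ^ 7 ≤ (2 ^ logSize n) ^ (3 * c + 1) * (2 ^ logSize n) ^ 7 := by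
            gcongr
            · exact le_two_pow_logSize n
            · calc 2 = 2 ^ 1 := by norm_num
                _ ≤ 2 ^ logSize n := Nat.pow_le_pow_right (by norm_num) hl
        _ = 2 ^ ((3 * c + 8) * logSize n) := by
            rw [← pow_add, ← pow_mul]; congr 1; ring
    exact_mod_cast h3
  have h4 : (2 : ℝ) ^ ((3 * c + 8) * logSize n) ≤ Real.exp (roundFactor c * logSize n / 10) := by
    have : (roundFactor c * logSize n / 10 : ℝ) = ((3 * c + 8) * logSize n : ℕ) * 1 := by
      unfold roundFactor; push_cast; ring
    rw [this, Real.exp_nat_mul]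
    refine pow_le_pow_left₀ (by norm_num) ?_ _
    linarith [Real.exp_one_gt_d9]
  rw [Real.exp_neg, ← div_eq_mul_inv, ← one_div, div_div,
    div_le_div_iff₀ (Real.exp_pos _) (by positivity)]
  have := h2.trans h4
  rw [pow_succ] at this
  linarith

/-! ### Messages that are received were held by some node -/

theorem exists_of_receive_eq_some {V : Type u} {M : Type} (G : Digraph V) (tx : V → Option M)
    (v : V) (y : M) (h : receive G tx v = some y) : ∃ u, tx u = some y := by
  unfold receive at h
  split_ifs at h
  exact ⟨_, h⟩

theorem exists_of_decay_eq_some {V : Type u} {M : Type} {l : ℕ} (G : Digraph V) (h : ℕ)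
    (msg : V → Option M) (coins : DecayCoins V l) (v : V) (y : M)
    (hy : decay G h msg coins v = some y) : ∃ u, msg u = some y := by
  unfold decay at hy
  obtain ⟨i, -, hi⟩ := List.exists_of_findSome?_eq_some hy
  split_ifs at hi
  obtain ⟨u, hu⟩ := exists_of_receive_eq_some G _ v y hi
  split_ifs at hu
  exact ⟨u, hu⟩

theorem exists_of_multiBroadcast_eq_some {V : Type u} {M : Type} {l Q : ℕ} (G : Digraph V)
    (h : ℕ → ℕ) (part : V → Bool) (f : V → Option M) (coins : Fin Q → DecayCoins V l) (v : V)
    (y : M) (hy : multiBroadcast G h part f coins v = some y) : ∃ u, f u = some y := by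
  unfold multiBroadcast at hy
  generalize List.finRange Q = L at hy
  induction L generalizing f v with
  | nil => exact ⟨v, hy⟩
  | cons q L ih =>
    obtain ⟨u, hu⟩ := ih _ _ hy
    rw [Option.or_eq_some_iff] at hu
    rcases hu with hu | ⟨-, hu⟩
    · exact ⟨u, hu⟩
    · split_ifs at hu
      exact exists_of_decay_eq_some G _ f _ u y hu

theorem multiBroadcast_of_eq_some {V : Type u} {M : Type} {l Q : ℕ} (G : Digraph V)
    (h : ℕ → ℕ) (part : V → Bool) (f : V → Option M) (coins : Fin Q → DecayCoins V l) (v : V)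
    (x : M) (hx : f v = some x) : multiBroadcast G h part f coins v = some x := by
  unfold multiBroadcast
  generalize List.finRange Q = L
  induction L generalizing f with
  | nil => exact hx
  | cons q L ih => exact ih _ (by simp [hx])

theorem multiBroadcast_eq_none {V : Type u} {M : Type} {l Q : ℕ} (G : Digraph V)
    (h : ℕ → ℕ) (part : V → Bool) (f : V → Option M) (coins : Fin Q → DecayCoins V l)
    (hf : ∀ v, f v = none) (v : V) : multiBroadcast G h part f coins v = none := by
  by_contra hne
  obtain ⟨y, hy⟩ := Option.ne_none_iff_exists'.1 hne
  obtain ⟨u, hu⟩ := exists_of_multiBroadcast_eq_some G h part f coins v y hy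
  simp [hf u] at hu

/-! ### Detection of conflicts -/

/-- The loop of Selection. -/
noncomputable def conflictLoop {V : Type u} {b l : ℕ} (G : Digraph V)
    (coins : Fin b → Fin 4 → DecayCoins V l) (m : V → Option (BitString b)) :
    V → Option (BitString b) × Bool :=
  (List.finRange b).foldl (fun s j => conflictStep G j (coins j) s) fun v => (m v, false)

theorem conflictStep_snd_of_snd {V : Type u} {b l : ℕ} (G : Digraph V) (j : Fin b)
    (coins : Fin 4 → DecayCoins V l) (s : V → Option (BitString b) × Bool) (v : V)
    (hv : (s v).2 = true) : (conflictStep G j coins s v).2 = true := by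
  unfold conflictStep
  split
  · exact hv
  · dsimp only
    split
    · rfl
    · exact hv

/-- A string is only ever modified together with setting the witness flag. -/
theorem conflictStep_eq_self {V : Type u} {b l : ℕ} (G : Digraph V) (j : Fin b)
    (coins : Fin 4 → DecayCoins V l) (s : V → Option (BitString b) × Bool)
    (h : ∀ v, (conflictStep G j coins s v).2 = false) : conflictStep G j coins s = s := by
  funext v
  have hv := h v
  unfold conflictStep at hv ⊢
  split at hv
  · rfl
  · dsimp only at hv ⊢
    split at hv
    · exact absurd hv (by simp)
    · rfl

theorem foldl_conflictStep_snd_of_snd {V : Type u} {b l : ℕ} (G : Digraph V)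
    (coins : Fin b → Fin 4 → DecayCoins V l) (L : List (Fin b))
    (s : V → Option (BitString b) × Bool) (v : V) (hv : (s v).2 = true) :
    (L.foldl (fun s j => conflictStep G j (coins j) s) s v).2 = true := by
  induction L generalizing s with
  | nil => exact hv
  | cons j L ih => exact ih _ (conflictStep_snd_of_snd G j (coins j) s v hv)

/-- If there is no witness in the end, then no iteration of the loop has changed anything. -/
theorem conflictStep_eq_self_of_mem {V : Type u} {b l : ℕ} (G : Digraph V)
    (coins : Fin b → Fin 4 → DecayCoins V l) (L : List (Fin b))
    (s : V → Option (BitString b) × Bool)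
    (h : ∀ v, (L.foldl (fun s j => conflictStep G j (coins j) s) s v).2 = false) :
    ∀ j ∈ L, conflictStep G j (coins j) s = s := by
  induction L generalizing s with
  | nil => simp
  | cons i L ih =>
    have hi : conflictStep G i (coins i) s = s := by
      refine conflictStep_eq_self G i (coins i) s fun v => ?_
      by_contra hne
      have := foldl_conflictStep_snd_of_snd G coins L _ v (Bool.eq_true_of_not_eq_false hne)
      have h2 := h v
      rw [List.foldl_cons, this] at h2
      exact absurd h2 (by simp)
    intro j hj
    rcases List.mem_cons.1 hj with rfl | hj
    · exact hi
    · refine ih s (fun v => ?_) j hj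
      have := h v
      rwa [List.foldl_cons, hi] at this

theorem decay_eq_none_of_conflictStep_eq_self {V : Type u} {b l : ℕ} (G : Digraph V) (j : Fin b)
    (coins : Fin 4 → DecayCoins V l) (m : V → Option (BitString b)) (v : V) (y : BitString b)
    (hv : m v = some y) (hy : y j = false)
    (h : conflictStep G j coins (fun v => (m v, false)) = fun v => (m v, false)) (r : Fin 4) :
    decay G l (fun u => (m u).filter fun y => y j) (coins r) v = none := by
  have h1 := congrFun h v
  unfold conflictStep at h1
  simp only [hv, hy] at h1
  by_contra hne
  have hs : ((List.finRange 4).findSome? fun r =>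
      decay G l (fun u => (m u).filter fun y => y j) (coins r) v).isSome := by
    rw [List.findSome?_isSome_iff]
    exact ⟨r, List.mem_finRange r, Option.isSome_iff_ne_none.2 hne⟩
  obtain ⟨z, hz⟩ := Option.isSome_iff_exists.1 hs
  rw [hz] at h1
  simp at h1

/-- An upper bound for the probability that a node with bit `y` does not hear its neighbours with
bit `x`. -/
noncomputable def missBound (x y : Bool) : ℝ≥0∞ :=
  if x && !y then ENNReal.ofReal (0.82 ^ 4) else 1

/-- Without a witness in the end, every bit position was processed with the original strings `m`.
The misses at `v` thus concern fixed senders and independent coins, and their probabilities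
multiply. Height `l` suffices however many nodes send, since `2 ^ l` exceeds or equals the number of
all nodes. -/
theorem measure_conflictLoop_le {V : Type u} [Fintype V] {b l : ℕ} (G : Digraph V)
    (hl : 1 ≤ l) (hV : Fintype.card V ≤ 2 ^ l) (m : V → Option (BitString b)) (u v : V)
    (huv : G.Adj u v) (x y : BitString b) (hu : m u = some x) (hv : m v = some y) :
    (Measure.pi fun _ : Fin b => Measure.pi fun _ : Fin 4 => decayLaw V l)
        {coins | ∀ w, (conflictLoop G coins m w).2 = false} ≤
      ∏ j, missBound (x j) (y j) := by
  let B : Fin b → Set (Fin 4 → DecayCoins V l) := fun j =>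
    if x j && !y j then
      Set.univ.pi fun _ => {coins | decay G l (fun u => (m u).filter fun y => y j) coins v = none}
    else Set.univ
  have hsub : {coins : Fin b → Fin 4 → DecayCoins V l |
      ∀ w, (conflictLoop G coins m w).2 = false} ⊆ Set.univ.pi B := by
    intro coins hc j _
    have h := conflictStep_eq_self_of_mem G coins (List.finRange b) _ hc j (List.mem_finRange j)
    simp only [B]
    split_ifs with hj
    · intro r _
      simp only [Bool.and_eq_true, Bool.not_eq_true'] at hj
      exact decay_eq_none_of_conflictStep_eq_self G j (coins j) m v y hv hj.2 h r
    · trivial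
  refine (measure_mono hsub).trans ?_
  rw [Measure.pi_pi]
  refine Finset.prod_le_prod' fun j _ => ?_
  simp only [B, missBound]
  split_ifs with hj
  · simp only [Bool.and_eq_true, Bool.not_eq_true'] at hj
    rw [Measure.pi_pi, ENNReal.ofReal_pow (by norm_num)]
    refine (Finset.prod_le_pow_card _ _ (ENNReal.ofReal 0.82) fun r _ => ?_).trans_eq (by simp)
    exact decayLaw_decay_eq_none_le G l _ v (by simp [hv, hj.2])
      ⟨u, huv, by simp [hu, hj.1]⟩ Finset.univ (fun _ _ _ => Finset.mem_univ _)
      (by rwa [Finset.card_univ]) hl le_rfl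
  · exact measure_univ.le

/-! ### Random identifiers -/

theorem lintegral_pi_prod {ι : Type*} [Fintype ι] {X : Type*} [MeasurableSpace X] [Countable X]
    [MeasurableSingletonClass X] (μ : Measure X) [IsProbabilityMeasure μ] (φ : ι → X → ℝ≥0∞) :
    ∫⁻ y, ∏ j, φ j (y j) ∂(Measure.pi fun _ : ι => μ) = ∏ j, ∫⁻ x, φ j x ∂μ := by
  have hφ : ∀ j, Measurable (φ j) := fun j => Measurable.of_discrete
  rw [lintegral_prod_eq_prod_lintegral_of_indepFun Finset.univ (fun j (y : ι → X) => φ j (y j))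
    (iIndepFun_pi fun j => (hφ j).aemeasurable)
    fun j => (hφ j).comp (measurable_pi_apply j)]
  refine Finset.prod_congr rfl fun j _ => ?_
  exact (measurePreserving_eval (fun _ : ι => μ) j).lintegral_comp (hφ j)

theorem lintegral_pi_pair {ι : Type*} [Fintype ι] {X : Type*} [MeasurableSpace X] [Countable X]
    [MeasurableSingletonClass X] (μ : Measure X) [IsProbabilityMeasure μ] (φ : X → X → ℝ≥0∞)
    (i j : ι) (hij : i ≠ j) :
    ∫⁻ f, φ (f i) (f j) ∂(Measure.pi fun _ : ι => μ) = ∫⁻ x, ∫⁻ y, φ x y ∂μ ∂μ := by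
  have h := Measure.infinitePi_map_eval_prod (P := fun _ : ι => μ) hij
  rw [Measure.infinitePi_eq_pi] at h
  rw [← lintegral_prod (fun z : X × X => φ z.1 z.2) Measurable.of_discrete.aemeasurable, ← h,
    lintegral_map Measurable.of_discrete
      ((measurable_pi_apply i).prodMk (measurable_pi_apply j))]

theorem lintegral_coin_two (φ : Bool → ℝ≥0∞) :
    ∫⁻ x, φ x ∂(coin 2) = (φ true + φ false) * ENNReal.ofReal (1 / 2) := by
  rw [lintegral_fintype]
  simp only [Fintype.univ_bool, Finset.mem_singleton, Bool.true_eq_false, not_false_eq_true,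
    Finset.sum_insert, Finset.sum_singleton, coin_true, coin_false]
  rw [add_mul]
  norm_num

/-- The probability that a conflict between two random identifiers is not noticed, per bit. -/
noncomputable def missRate : ℝ := (3 + 0.82 ^ 4) / 4

theorem lintegral_missBound :
    ∫⁻ x, ∫⁻ y, missBound x y ∂(coin 2) ∂(coin 2) = ENNReal.ofReal missRate := by
  simp only [lintegral_coin_two, missBound, missRate]
  simp only [Bool.not_true, Bool.and_false, Bool.not_false, Bool.and_true, Bool.false_eq_true,
    if_false, if_true, ← ENNReal.ofReal_one]
  rw [← ENNReal.ofReal_add (by norm_num) (by norm_num),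
    ← ENNReal.ofReal_add (by norm_num) (by norm_num), ← ENNReal.ofReal_mul (by norm_num),
    ← ENNReal.ofReal_mul (by norm_num), ← ENNReal.ofReal_add (by norm_num) (by norm_num),
    ← ENNReal.ofReal_mul (by norm_num)]
  norm_num

theorem lintegral_prod_missBound {V : Type u} [Fintype V] (b : ℕ) (v w : V) (hvw : v ≠ w) :
    ∫⁻ f : V → BitString b, ∏ j, missBound (f v j) (f w j)
        ∂(Measure.pi fun _ : V => Measure.pi fun _ : Fin b => coin 2) =
      ENNReal.ofReal (missRate ^ b) := by
  rw [lintegral_pi_pair (Measure.pi fun _ : Fin b => coin 2)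
    (fun x y => ∏ j, missBound (x j) (y j)) v w hvw]
  have h1 : ∀ x : BitString b, ∫⁻ y : BitString b, ∏ j, missBound (x j) (y j)
      ∂(Measure.pi fun _ : Fin b => coin 2) = ∏ j, ∫⁻ y, missBound (x j) y ∂(coin 2) :=
    fun x => lintegral_pi_prod (coin 2) fun j y => missBound (x j) y
  simp only [h1]
  rw [lintegral_pi_prod (coin 2) fun _ x => ∫⁻ y, missBound x y ∂(coin 2)]
  simp only [lintegral_missBound, Finset.prod_const, Finset.card_univ, Fintype.card_fin]
  rw [ENNReal.ofReal_pow (by unfold missRate; norm_num)]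

/-- The 16 in the identifier length is what makes `missRate ^ 16 ≤ 1 / 8`, that is, three binary
orders per factor `c * logSize n`. -/
theorem missRate_pow_idLength_le (c n : ℕ) (hn : 2 ≤ n) :
    missRate ^ idLength c n ≤ ((n : ℝ) ^ (3 * c))⁻¹ := by
  have h16 : missRate ^ 16 ≤ (2 ^ 3 : ℝ)⁻¹ := by unfold missRate; norm_num
  have h0 : 0 ≤ missRate := by unfold missRate; norm_num
  rw [idLength, mul_assoc, pow_mul]
  calc (missRate ^ 16) ^ (c * logSize n) ≤ ((2 ^ 3 : ℝ)⁻¹) ^ (c * logSize n) :=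
        pow_le_pow_left₀ (by positivity) h16 _
    _ = ((2 ^ logSize n : ℝ) ^ (3 * c))⁻¹ := by
        rw [inv_pow, ← pow_mul, ← pow_mul]; congr 2; ring
    _ ≤ ((n : ℝ) ^ (3 * c))⁻¹ := by
        have : (n : ℝ) ≤ 2 ^ logSize n := by exact_mod_cast le_two_pow_logSize n
        have : (0 : ℝ) < n := by positivity
        gcongr

/-! ### Selection -/

section Selection

variable {V : Type u} {b l Q : ℕ}

theorem conflictLoop_fst_ne_none (G : Digraph V) (coins : Fin b → Fin 4 → DecayCoins V l)
    (m : V → Option (BitString b)) (v : V) (hv : m v ≠ none) :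
    (conflictLoop G coins m v).1 ≠ none := by
  have key : ∀ (L : List (Fin b)) (s : V → Option (BitString b) × Bool), (s v).1 ≠ none →
      (L.foldl (fun s j => conflictStep G j (coins j) s) s v).1 ≠ none := by
    intro L
    induction L with
    | nil => exact fun s hs => hs
    | cons j L ih =>
      intro s hs
      refine ih _ ?_
      change (conflictStep G j (coins j) s v).1 ≠ none
      unfold conflictStep
      split
      · exact hs
      · dsimp only
        split
        · simp
        · exact hs
  exact key _ _ hv

/-- A witness would hold a string with bit 0 and hear one with bit 1, but there is only one string
in the network. -/
theorem conflictStep_of_forall_eq (G : Digraph V) (j : Fin b) (coins : Fin 4 → DecayCoins V l)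
    (m : V → Option (BitString b)) (x : BitString b) (hm : ∀ v y, m v = some y → y = x) :
    conflictStep G j coins (fun v => (m v, false)) = fun v => (m v, false) := by
  funext v
  unfold conflictStep
  split
  · rfl
  · rename_i y hy
    dsimp only at hy ⊢
    split
    · rename_i z hyj hz
      exfalso
      obtain ⟨r, -, hr⟩ := List.exists_of_findSome?_eq_some hz
      obtain ⟨u, hu⟩ := exists_of_decay_eq_some G _ _ _ v z hr
      rw [Option.filter_eq_some_iff] at hu
      rw [hm v y hy] at hyj
      rw [hm u z hu.1, hyj] at hu
      exact absurd hu.2 (by simp)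
    · rfl

theorem conflictLoop_of_forall_eq (G : Digraph V) (coins : Fin b → Fin 4 → DecayCoins V l)
    (m : V → Option (BitString b)) (x : BitString b) (hm : ∀ v y, m v = some y → y = x) :
    conflictLoop G coins m = fun v => (m v, false) := by
  unfold conflictLoop
  generalize List.finRange b = L
  induction L with
  | nil => rfl
  | cons j L ih =>
    rw [List.foldl_cons, conflictStep_of_forall_eq G j (coins j) m x hm]
    exact ih

/-- The sources of the second broadcast of Selection. -/
def witnessString (s : V → Option (BitString b) × Bool) (v : V) : Option (BitString b) :=
  if (s v).2 then (s v).1 else none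

/-- A single string creates no witness, so the second broadcast has no source and stays empty
whatever the coins are. Only `v` has to be reached by the first broadcast. -/
theorem selection_of_forall_eq (G : Digraph V) (h : ℕ → ℕ) (act : V → Bool)
    (ids : V → Option (BitString b)) (c₁ : Fin Q → DecayCoins V l)
    (c₂ : Fin b → Fin 4 → DecayCoins V l) (c₃ : Fin Q → DecayCoins V l) (x : BitString b)
    (hids : ∀ v y, ids v = some y → y = x) (v : V)
    (hv : multiBroadcast G h act ids c₁ v ≠ none) :
    selection G h act ids c₁ c₂ c₃ v = (some x, true) := by
  have hm : ∀ w y, multiBroadcast G h act ids c₁ w = some y → y = x := by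
    intro w y hy
    obtain ⟨u, hu⟩ := exists_of_multiBroadcast_eq_some G h act ids c₁ w y hy
    exact hids u y hu
  have hloop := conflictLoop_of_forall_eq G c₂ _ x hm
  obtain ⟨y, hy⟩ := Option.ne_none_iff_exists'.1 hv
  have hp : multiBroadcast G h (fun v => (multiBroadcast G h act ids c₁ v).isSome)
      (witnessString (conflictLoop G c₂ (multiBroadcast G h act ids c₁))) c₃ v = none := by
    refine multiBroadcast_eq_none G h _ _ c₃ (fun w => ?_) v
    rw [witnessString, hloop]
    rfl
  change (match multiBroadcast G h act ids c₁ v,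
    multiBroadcast G h (fun v => (multiBroadcast G h act ids c₁ v).isSome)
      (witnessString (conflictLoop G c₂ (multiBroadcast G h act ids c₁))) c₃ v with
    | none, _ => (none, false)
    | some _, none => ((conflictLoop G c₂ (multiBroadcast G h act ids c₁) v).1, true)
    | some _, some y => (some y, false)) = _
  rw [hp, hloop, hy]
  dsimp only
  rw [hy, hm v y hy]

theorem selection_of_eq_some (G : Digraph V) (h : ℕ → ℕ) (act : V → Bool)
    (ids : V → Option (BitString b)) (c₁ : Fin Q → DecayCoins V l)
    (c₂ : Fin b → Fin 4 → DecayCoins V l) (c₃ : Fin Q → DecayCoins V l) (v : V)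
    (hp : multiBroadcast G h (fun v => (multiBroadcast G h act ids c₁ v).isSome)
      (witnessString (conflictLoop G c₂ (multiBroadcast G h act ids c₁))) c₃ v ≠ none) :
    (selection G h act ids c₁ c₂ c₃ v).2 = false := by
  obtain ⟨y, hy⟩ := Option.ne_none_iff_exists'.1 hp
  change (match multiBroadcast G h act ids c₁ v,
    multiBroadcast G h (fun v => (multiBroadcast G h act ids c₁ v).isSome)
      (witnessString (conflictLoop G c₂ (multiBroadcast G h act ids c₁))) c₃ v with
    | none, _ => (none, false)
    | some _, none => ((conflictLoop G c₂ (multiBroadcast G h act ids c₁) v).1, true)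
    | some _, some y => (some y, false)).2 = _
  rw [hy]
  split <;> simp_all

theorem selection_of_eq_none (G : Digraph V) (h : ℕ → ℕ) (act : V → Bool)
    (ids : V → Option (BitString b)) (c₁ : Fin Q → DecayCoins V l)
    (c₂ : Fin b → Fin 4 → DecayCoins V l) (c₃ : Fin Q → DecayCoins V l) (v : V)
    (hm : multiBroadcast G h act ids c₁ v = none) :
    (selection G h act ids c₁ c₂ c₃ v).2 = false := by
  simp only [selection, hm]

end Selection

/-! ### One iteration of the main loop -/

section Iteration

variable {V : Type u} {b l Q : ℕ}

/-- The identifiers of the candidates. -/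
def candidateIds (st : V → Status b) (r : IterationCoins V b l Q) (v : V) :
    Option (BitString b) :=
  if (st v).isNone && r.1 v then some (r.2.1 v) else none

theorem iteration_of_isSome (G : Digraph V) (h : ℕ → ℕ) (st : V → Status b)
    (r : IterationCoins V b l Q) (v : V) (hv : (st v).isSome) : iteration G h st r v = st v := by
  have : (st v).isNone = false := by simpa using hv
  simp only [iteration, this, Bool.false_eq_true, if_false]

theorem iteration_of_snd_eq_false (G : Digraph V) (h : ℕ → ℕ) (st : V → Status b)
    (r : IterationCoins V b l Q) (v : V) (hv : st v = none)
    (hs : (selection G h (fun v => (st v).isNone) (candidateIds st r) r.2.2.1 r.2.2.2.1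
      r.2.2.2.2 v).2 = false) : iteration G h st r v = none := by
  change (if (st v).isNone then match selection G h (fun v => (st v).isNone) (candidateIds st r)
      r.2.2.1 r.2.2.2.1 r.2.2.2.2 v with
    | (some y, true) => some (y, candidateIds st r v)
    | _ => none else st v) = none
  rw [hv, Option.isNone_none, if_pos rfl]
  split
  · rename_i y heq
    rw [heq] at hs
    exact absurd hs (by simp)
  · rfl

theorem iteration_of_eq_some (G : Digraph V) (h : ℕ → ℕ) (st : V → Status b)
    (r : IterationCoins V b l Q) (v : V) (hv : st v = none) (y : BitString b)
    (hs : selection G h (fun v => (st v).isNone) (candidateIds st r) r.2.2.1 r.2.2.2.1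
      r.2.2.2.2 v = (some y, true)) : iteration G h st r v = some (y, candidateIds st r v) := by
  change (if (st v).isNone then match selection G h (fun v => (st v).isNone) (candidateIds st r)
      r.2.2.1 r.2.2.2.1 r.2.2.2.2 v with
    | (some y, true) => some (y, candidateIds st r v)
    | _ => none else st v) = _
  rw [hv, Option.isNone_none, if_pos rfl, hs]

/-- A node that is the only candidate terminates, and so does every node that it reaches. -/
theorem iteration_of_only_candidate (G : Digraph V) (h : ℕ → ℕ) (st : V → Status b)
    (r : IterationCoins V b l Q) (v : V) (hv : ∀ w, w ≠ v → r.1 w = false)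
    (w : V) (hw : st w = none)
    (hm : multiBroadcast G h (fun v => (st v).isNone) (candidateIds st r) r.2.2.1 w ≠ none) :
    iteration G h st r w = some (r.2.1 v, candidateIds st r w) := by
  refine iteration_of_eq_some G h st r w hw _ ?_
  refine selection_of_forall_eq G h _ _ _ _ _ _ (fun u y hu => ?_) w hm
  unfold candidateIds at hu
  split_ifs at hu with hc
  have huv : u = v := by
    by_contra hne
    simp [hv u hne] at hc
  rw [huv] at hu
  exact (Option.some.inj hu).symm

theorem iteration_isSome_of_only_candidate (G : Digraph V) (h : ℕ → ℕ) (st : V → Status b)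
    (r : IterationCoins V b l Q) (v : V) (hst : st v = none) (hrv : r.1 v = true)
    (hv : ∀ w, w ≠ v → r.1 w = false) : (iteration G h st r v).isSome := by
  have hc : candidateIds st r v = some (r.2.1 v) := by simp [candidateIds, hst, hrv]
  rw [iteration_of_only_candidate G h st r v hv v hst
    (by rw [multiBroadcast_of_eq_some G h _ _ _ v _ hc]; simp)]
  rfl

/-- The status of all nodes at the beginning. -/
def initial (V : Type u) (b : ℕ) : V → Status b := fun _ => none

/-- All nodes have terminated with the same output, which is the own identifier of one of them. -/
def Elected (st : V → Status b) : Prop :=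
  ∃ y : BitString b, (∀ v, ∃ own, st v = some (y, own)) ∧ ∃! v, st v = some (y, some y)

theorem Elected.iteration_eq {st : V → Status b} (hst : Elected st) (G : Digraph V) (h : ℕ → ℕ)
    (r : IterationCoins V b l Q) : iteration G h st r = st := by
  obtain ⟨y, hy, -⟩ := hst
  funext v
  obtain ⟨own, ho⟩ := hy v
  exact iteration_of_isSome G h st r v (by simp [ho])

/-- The strings after the first broadcast of the first iteration. -/
noncomputable def firstStrings (G : Digraph V) (h : ℕ → ℕ) (r : IterationCoins V b l Q) :
    V → Option (BitString b) :=
  multiBroadcast G h (fun v => (initial V b v).isNone) (candidateIds (initial V b) r) r.2.2.1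

/-- There is a candidate, but the first broadcast does not reach all nodes. -/
def FirstBroadcastFails (G : Digraph V) (h : ℕ → ℕ) (r : IterationCoins V b l Q) : Prop :=
  (∃ v, r.1 v = true) ∧ ∃ v, firstStrings G h r v = none

/-- There are several candidates, but no conflict is detected. -/
def DetectionFails (G : Digraph V) (h : ℕ → ℕ) (r : IterationCoins V b l Q) : Prop :=
  (∀ v, firstStrings G h r v ≠ none) ∧ (∃ v w, v ≠ w ∧ r.1 v = true ∧ r.1 w = true) ∧
    ∀ v, (conflictLoop G r.2.2.2.1 (firstStrings G h r) v).2 = false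

/-- There is a witness of a conflict, but the second broadcast does not reach all nodes. -/
def SecondBroadcastFails (G : Digraph V) (h : ℕ → ℕ) (r : IterationCoins V b l Q) : Prop :=
  (∀ v, firstStrings G h r v ≠ none) ∧
    (∃ v, (conflictLoop G r.2.2.2.1 (firstStrings G h r) v).2 = true) ∧
    ∃ v, multiBroadcast G h (fun v => (firstStrings G h r v).isSome)
      (witnessString (conflictLoop G r.2.2.2.1 (firstStrings G h r))) r.2.2.2.2 v = none

theorem elected_of_only_candidate (G : Digraph V) (h : ℕ → ℕ) (r : IterationCoins V b l Q)
    (v : V) (hrv : r.1 v = true) (hv : ∀ w, w ≠ v → r.1 w = false)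
    (hF : ¬ FirstBroadcastFails G h r) : Elected (iteration G h (initial V b) r) := by
  have hall : ∀ w, firstStrings G h r w ≠ none := fun w hw => hF ⟨⟨v, hrv⟩, w, hw⟩
  have hit : ∀ w, iteration G h (initial V b) r w =
      some (r.2.1 v, candidateIds (initial V b) r w) := fun w =>
    iteration_of_only_candidate G h (initial V b) r v hv w rfl (hall w)
  refine ⟨r.2.1 v, fun w => ⟨_, hit w⟩, v, ?_, fun w hw => ?_⟩
  · change iteration G h (initial V b) r v = _
    rw [hit v]; simp [candidateIds, initial, hrv]
  · by_contra hne
    change iteration G h (initial V b) r w = _ at hw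
    rw [hit w] at hw
    simp [candidateIds, hv w hne] at hw

/-- The first iteration elects a leader or changes nothing, unless something fails. -/
theorem iteration_initial (G : Digraph V) (h : ℕ → ℕ) (r : IterationCoins V b l Q)
    (h1 : ¬ FirstBroadcastFails G h r) (h2 : ¬ DetectionFails G h r)
    (h3 : ¬ SecondBroadcastFails G h r) :
    iteration G h (initial V b) r = initial V b ∨ Elected (iteration G h (initial V b) r) := by
  by_cases hc : ∃ v, r.1 v = true
  swap
  · left
    funext v
    refine iteration_of_snd_eq_false G h _ r v rfl (selection_of_eq_none G h _ _ _ _ _ v ?_)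
    refine multiBroadcast_eq_none G h _ _ _ (fun w => ?_) v
    have : r.1 w = false := by
      by_contra hne
      exact hc ⟨w, Bool.eq_true_of_not_eq_false hne⟩
    simp [candidateIds, this]
  have hall : ∀ w, firstStrings G h r w ≠ none := fun w hw => h1 ⟨hc, w, hw⟩
  obtain ⟨v, hv⟩ := hc
  by_cases huniq : ∀ w, w ≠ v → r.1 w = false
  · exact Or.inr (elected_of_only_candidate G h r v hv huniq h1)
  -- Several candidates: a witness exists and its string reaches everybody, so each node gets flag
  -- `false` and keeps running.
  · left
    push Not at huniq
    obtain ⟨w, hwv, hw⟩ := huniq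
    have hwit : ∃ v, (conflictLoop G r.2.2.2.1 (firstStrings G h r) v).2 = true := by
      by_contra hno
      push Not at hno
      exact h2 ⟨hall, ⟨w, v, hwv, Bool.eq_true_of_not_eq_false hw, hv⟩,
        fun u => Bool.eq_false_of_not_eq_true (hno u)⟩
    funext u
    refine iteration_of_snd_eq_false G h _ r u rfl (selection_of_eq_some G h _ _ _ _ _ u ?_)
    exact fun hu => h3 ⟨hall, hwit, u, hu⟩

end Iteration

/-! ### Failure probabilities of one iteration -/

/-- An edge across which the strings differ, if they are not all equal. -/
theorem exists_adj_ne {V : Type u} {M : Type} (G : Digraph V) (hG : StronglyConnected G) (m : V → M) (v w : V)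
    (hvw : m v ≠ m w) : ∃ u u', G.Adj u u' ∧ m u ≠ m u' := by
  by_contra hno
  push Not at hno
  refine hvw ?_
  clear hvw
  induction hG v w with
  | refl => rfl
  | tail _ hbc ih => exact ih.trans (hno _ _ hbc)

section Failure

variable {V : Type u} [Fintype V] {b l Q : ℕ}

theorem iterationLaw_firstBroadcastFails_le (G : Digraph V) (h : ℕ → ℕ) (n : ℕ) (δ : ℝ≥0∞)
    (hδ : ∀ (f : V → Option (BitString b)) (part : V → Bool), (∀ v, part v = true) →
      (∃ v, f v ≠ none) → (Measure.pi fun _ : Fin Q => decayLaw V l)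
        {coins | ∃ v, multiBroadcast G h part f coins v = none} ≤ δ) :
    iterationLaw V n b l Q {r | FirstBroadcastFails G h r} ≤ δ := by
  unfold iterationLaw
  refine measure_prod_le_of_forall _ _ _ _ fun a => ?_
  refine measure_prod_le_of_forall _ _ _ _ fun ids => ?_
  let f : V → Option (BitString b) := fun v => if a v then some (ids v) else none
  by_cases ha : ∃ v, a v = true
  · refine le_trans (measure_mono (t := {z : (Fin Q → DecayCoins V l) ×
        (Fin b → Fin 4 → DecayCoins V l) × (Fin Q → DecayCoins V l) |
        ∃ v, multiBroadcast G h (fun _ => true) f z.1 v = none}) fun z hz => hz.2) ?_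
    rw [measure_prod_fst _ _ fun c : Fin Q → DecayCoins V l =>
      ∃ v, multiBroadcast G h (fun _ => true) f c v = none]
    refine hδ f _ (fun _ => rfl) ?_
    obtain ⟨v, hv⟩ := ha
    exact ⟨v, by simp [f, hv]⟩
  · refine le_trans (measure_mono (t := ∅) fun z hz => ha hz.1) (by simp)

theorem iterationLaw_secondBroadcastFails_le (G : Digraph V) (h : ℕ → ℕ) (n : ℕ) (δ : ℝ≥0∞)
    (hδ : ∀ (f : V → Option (BitString b)) (part : V → Bool), (∀ v, part v = true) →
      (∃ v, f v ≠ none) → (Measure.pi fun _ : Fin Q => decayLaw V l)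
        {coins | ∃ v, multiBroadcast G h part f coins v = none} ≤ δ) :
    iterationLaw V n b l Q {r | SecondBroadcastFails G h r} ≤ δ := by
  unfold iterationLaw
  refine measure_prod_le_of_forall _ _ _ _ fun a => ?_
  refine measure_prod_le_of_forall _ _ _ _ fun ids => ?_
  refine measure_prod_le_of_forall _ _ _ _ fun c₁ => ?_
  refine measure_prod_le_of_forall _ _ _ _ fun c₂ => ?_
  let f : V → Option (BitString b) := fun v => if a v then some (ids v) else none
  let m : V → Option (BitString b) := multiBroadcast G h (fun _ => true) f c₁
  by_cases hm : (∀ v, m v ≠ none) ∧ ∃ v, (conflictLoop G c₂ m v).2 = true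
  · obtain ⟨hm, v, hv⟩ := hm
    refine le_trans (measure_mono fun z hz => hz.2.2) (hδ
      (witnessString (conflictLoop G c₂ m)) (fun v => (m v).isSome)
      (fun v => Option.isSome_iff_ne_none.2 (hm v)) ⟨v, ?_⟩)
    rw [witnessString, if_pos hv]
    exact conflictLoop_fst_ne_none G c₂ m v (hm v)
  · refine le_trans (measure_mono (t := ∅) fun z hz => hm ⟨hz.1, hz.2.1⟩) (by simp)

open Classical in
/-- The sum over all pairs of distinct candidates of the probabilities that their conflict is not
detected. -/
noncomputable def pairBound (a : V → Bool) (ids : V → BitString b) : ℝ≥0∞ :=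
  ∑ z ∈ (Finset.univ : Finset V).offDiag,
    (if a z.1 && a z.2 then 1 else 0) * ∏ j, missBound (ids z.1 j) (ids z.2 j)

theorem le_pairBound (a : V → Bool) (ids : V → BitString b) (v w : V) (hvw : v ≠ w)
    (hv : a v = true) (hw : a w = true) :
    ∏ j, missBound (ids v j) (ids w j) ≤ pairBound a ids := by
  classical
  unfold pairBound
  have hmem : (v, w) ∈ (Finset.univ : Finset V).offDiag := by simp [hvw]
  refine le_trans ?_ (Finset.single_le_sum (f := fun z : V × V =>
    (if a z.1 && a z.2 then (1 : ℝ≥0∞) else 0) * ∏ j, missBound (ids z.1 j) (ids z.2 j))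
    (fun _ _ => zero_le) hmem)
  simp [hv, hw]

/-- The edge with different strings depends on the coins of the first broadcast, but its two strings
are identifiers of two distinct candidates. The sum over all pairs of candidates therefore
dominates, independently of those coins. -/
theorem measure_detectionFails_slice_le (G : Digraph V) (hG : StronglyConnected G) (hl : 1 ≤ l)
    (hV : Fintype.card V ≤ 2 ^ l) (a : V → Bool) (ids : V → BitString b)
    (m : V → Option (BitString b)) (hm : ∀ v, m v ≠ none)
    (hkeep : ∀ v, a v = true → m v = some (ids v))
    (hval : ∀ v y, m v = some y → ∃ u, a u = true ∧ ids u = y)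
    (hpair : ∃ v w, v ≠ w ∧ a v = true ∧ a w = true) :
    (Measure.pi fun _ : Fin b => Measure.pi fun _ : Fin 4 => decayLaw V l)
        {coins | ∀ v, (conflictLoop G coins m v).2 = false} ≤ pairBound a ids := by
  obtain ⟨v, w, hvw, hv, hw⟩ := hpair
  -- Candidates keep their own identifiers, so equality here means a collision of identifiers. Then
  -- every factor `missBound` is 1 and the bound is trivial; collisions are thus accounted for in
  -- the same average.
  by_cases heq : m v = m w
  · rw [hkeep v hv, hkeep w hw, Option.some.injEq] at heq
    refine le_trans ?_ (le_pairBound a ids v w hvw hv hw)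
    rw [heq]
    simp [missBound, prob_le_one]
  · obtain ⟨u, u', hadj, hne⟩ := exists_adj_ne G hG m v w heq
    obtain ⟨x, hx⟩ := Option.ne_none_iff_exists'.1 (hm u)
    obtain ⟨y, hy⟩ := Option.ne_none_iff_exists'.1 (hm u')
    obtain ⟨z, hz, hzx⟩ := hval u x hx
    obtain ⟨z', hz', hzy⟩ := hval u' y hy
    refine (measure_conflictLoop_le G hl hV m u u' hadj x y hx hy).trans ?_
    rw [← hzx, ← hzy]
    refine le_pairBound a ids z z' ?_ hz hz'
    rintro rfl
    rw [hx, hy, ← hzx, ← hzy] at hne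
    exact hne rfl

theorem lintegral_pairBound (a : V → Bool) :
    ∫⁻ ids, pairBound a ids ∂(Measure.pi fun _ : V => Measure.pi fun _ : Fin b => coin 2) =
      (∑ z ∈ (Finset.univ : Finset V).offDiag, (if a z.1 && a z.2 then 1 else 0)) *
        ENNReal.ofReal (missRate ^ b) := by
  classical
  unfold pairBound
  rw [lintegral_finsetSum _ fun _ _ => Measurable.of_discrete, Finset.sum_mul]
  refine Finset.sum_congr (by congr!) fun z hz => ?_
  rw [lintegral_const_mul _ Measurable.of_discrete,
    lintegral_prod_missBound b z.1 z.2 (by simpa using hz)]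

/-- There are at most `n ^ 2` ordered pairs, and both members are candidates with probability `1 / n
^ 2`. -/
theorem lintegral_sum_pairs_le (n : ℕ) (hn : n = Fintype.card V) (hn2 : 2 ≤ n) :
    ∫⁻ a : V → Bool, (∑ z ∈ (Finset.univ : Finset V).offDiag,
      (if a z.1 && a z.2 then (1 : ℝ≥0∞) else 0)) ∂(Measure.pi fun _ : V => coin n) ≤ 1 := by
  classical
  rw [lintegral_finsetSum _ fun _ _ => Measurable.of_discrete]
  have hn0 : (0 : ℝ) < n := by positivity
  have hterm : ∀ z ∈ (Finset.univ : Finset V).offDiag,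
      ∫⁻ a : V → Bool, (if a z.1 && a z.2 then (1 : ℝ≥0∞) else 0)
        ∂(Measure.pi fun _ : V => coin n) ≤ ENNReal.ofReal ((n : ℝ)⁻¹ * (n : ℝ)⁻¹) := by
    intro z hz
    rw [lintegral_pi_pair (coin n) (fun x y => if x && y then (1 : ℝ≥0∞) else 0) z.1 z.2
      (by simpa using hz)]
    simp only [lintegral_fintype, Fintype.univ_bool]
    simp [ENNReal.ofReal_mul, coin_true]
  refine (Finset.sum_le_card_nsmul _ _ _ hterm).trans ?_
  rw [nsmul_eq_mul, ← ENNReal.ofReal_natCast, ← ENNReal.ofReal_mul (by positivity)]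
  rw [ENNReal.ofReal_le_one]
  have hcard : ((Finset.univ : Finset V).offDiag.card : ℝ) ≤ n * n := by
    rw [Finset.offDiag_card, Finset.card_univ, ← hn]
    exact_mod_cast Nat.sub_le _ _
  calc _ ≤ (n : ℝ) * n * ((n : ℝ)⁻¹ * (n : ℝ)⁻¹) := by gcongr
    _ = 1 := by field_simp

theorem iterationLaw_detectionFails_le (G : Digraph V) (hG : StronglyConnected G) (h : ℕ → ℕ)
    (n : ℕ) (hn : n = Fintype.card V) (hn2 : 2 ≤ n) (hl : 1 ≤ l) (hV : n ≤ 2 ^ l) :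
    iterationLaw V n b l Q {r | DetectionFails G h r} ≤ ENNReal.ofReal (missRate ^ b) := by
  classical
  unfold iterationLaw
  rw [Measure.prod_apply (Set.toFinite _).measurableSet]
  calc _ ≤ ∫⁻ a : V → Bool, (∑ z ∈ (Finset.univ : Finset V).offDiag,
        (if a z.1 && a z.2 then (1 : ℝ≥0∞) else 0)) * ENNReal.ofReal (missRate ^ b)
          ∂(Measure.pi fun _ : V => coin n) := by
        refine lintegral_mono fun a => ?_
        dsimp only
        rw [← lintegral_pairBound, Measure.prod_apply (Set.toFinite _).measurableSet]
        refine lintegral_mono fun ids => ?_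
        refine measure_prod_le_of_forall _ _ _ _ fun c₁ => ?_
        let f : V → Option (BitString b) := fun v => if a v then some (ids v) else none
        let m : V → Option (BitString b) := multiBroadcast G h (fun _ => true) f c₁
        by_cases hm : (∀ v, m v ≠ none) ∧ ∃ v w, v ≠ w ∧ a v = true ∧ a w = true
        · refine le_trans (measure_mono (t := {z : (Fin b → Fin 4 → DecayCoins V l) ×
            (Fin Q → DecayCoins V l) | ∀ v, (conflictLoop G z.1 m v).2 = false})
            fun z hz => hz.2.2) ?_
          rw [measure_prod_fst _ _ fun c₂ : Fin b → Fin 4 → DecayCoins V l =>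
            ∀ v, (conflictLoop G c₂ m v).2 = false]
          refine measure_detectionFails_slice_le G hG hl (hn ▸ hV) a ids m hm.1 ?_ ?_ hm.2
          · intro v hv
            exact multiBroadcast_of_eq_some G h _ f c₁ v _ (by simp [f, hv])
          · intro v y hy
            obtain ⟨u, hu⟩ := exists_of_multiBroadcast_eq_some G h _ f c₁ v y hy
            simp only [f] at hu
            split_ifs at hu with hau
            exact ⟨u, hau, Option.some.inj hu⟩
        · refine le_trans (measure_mono (t := ∅) fun z hz => hm ⟨hz.1, hz.2.1⟩) (by simp)
    _ = (∫⁻ a : V → Bool, (∑ z ∈ (Finset.univ : Finset V).offDiag,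
        (if a z.1 && a z.2 then (1 : ℝ≥0∞) else 0)) ∂(Measure.pi fun _ : V => coin n)) *
          ENNReal.ofReal (missRate ^ b) := lintegral_mul_const _ Measurable.of_discrete
    _ ≤ 1 * ENNReal.ofReal (missRate ^ b) := by
        gcongr
        exact lintegral_sum_pairs_le n hn hn2
    _ = _ := one_mul _

theorem coin_compl_true (n : ℕ) : coin n {true}ᶜ = ENNReal.ofReal (1 - (n : ℝ)⁻¹) := by
  rw [← coin_false]
  congr 1
  ext x
  cases x <;> simp

theorem le_iterationLaw_only_candidate (n : ℕ) (hn : n = Fintype.card V) (hn2 : 2 ≤ n) (v : V) :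
    ENNReal.ofReal ((n : ℝ)⁻¹ * Real.exp (-1)) ≤
      iterationLaw V n b l Q {r | r.1 v = true ∧ ∀ w, w ≠ v → r.1 w = false} := by
  unfold iterationLaw
  rw [measure_prod_fst _ _ fun a : V → Bool => a v = true ∧ ∀ w, w ≠ v → a w = false]
  refine (le_measure_pi_only (coin n) {true} Finset.univ v (Finset.mem_univ v) n hn2
    (by rw [Finset.card_univ, hn]) (coin_true n) (coin_compl_true n)).trans ?_
  exact measure_mono fun a ha => ⟨ha.1, fun w hw => by simpa using ha.2 w (Finset.mem_univ w) hw⟩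

theorem le_iterationLaw_exists_only_candidate (n : ℕ) (hn : n = Fintype.card V) (hn2 : 2 ≤ n) :
    ENNReal.ofReal (Real.exp (-1)) ≤
      iterationLaw V n b l Q {r | ∃ v, r.1 v = true ∧ ∀ w, w ≠ v → r.1 w = false} := by
  unfold iterationLaw
  rw [measure_prod_fst _ _ fun a : V → Bool => ∃ v, a v = true ∧ ∀ w, w ≠ v → a w = false]
  have h := le_measure_pi_exists_only (coin n) {true} (MeasurableSet.singleton _)
    (Finset.univ : Finset V) n hn2
    (by rw [Finset.card_univ, hn]) (coin_true n) (coin_compl_true n)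
  have hn0 : (n : ℝ) ≠ 0 := by positivity
  rw [Finset.card_univ, ← hn, mul_inv_cancel_left₀ hn0] at h
  refine h.trans (measure_mono ?_)
  rintro a ⟨v, -, hv, hw⟩
  exact ⟨v, hv, fun w hwv => by simpa using hw w (Finset.mem_univ w) hwv⟩

end Failure

/-! ### The first iteration -/

section Initial

variable {V : Type u} [Fintype V]

/-- The three uses of the exponent `3 c`: broadcast failures are negligible against the success
probability, going wrong outweighs the `O(n ^ 2)` iterations it may cost, and the error stays below
`n ^ (-c)`. -/
theorem inv_pow_three_mul_le (c n : ℕ) (hc : 1 ≤ c) (hn2 : 2 ≤ n) :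
    ((n : ℝ) ^ (3 * c))⁻¹ ≤ 1 / 8 ∧ n ^ 2 * ((n : ℝ) ^ (3 * c))⁻¹ ≤ 1 / 2 ∧
      ((n : ℝ) ^ (3 * c))⁻¹ ≤ 1 / 4 * ((n : ℝ) ^ c)⁻¹ := by
  have hn : (2 : ℝ) ≤ n := by exact_mod_cast hn2
  have hn0 : (0 : ℝ) < n := by linarith
  have h3 : (n : ℝ) ^ 3 ≤ (n : ℝ) ^ (3 * c) := pow_le_pow_right₀ (by linarith) (by omega)
  have h8 : (8 : ℝ) ≤ (n : ℝ) ^ 3 := by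
    calc (8 : ℝ) = 2 ^ 3 := by norm_num
      _ ≤ _ := by gcongr
  refine ⟨?_, ?_, ?_⟩
  · rw [inv_eq_one_div]
    exact one_div_le_one_div_of_le (by norm_num) (h8.trans h3)
  · rw [← div_eq_mul_inv, div_le_div_iff₀ (by positivity) (by norm_num)]
    nlinarith [sq_nonneg (n : ℝ)]
  · have h2 : (4 : ℝ) ≤ (n : ℝ) ^ (2 * c) := by
      calc (4 : ℝ) = 2 ^ 2 := by norm_num
        _ ≤ (n : ℝ) ^ 2 := by gcongr
        _ ≤ _ := pow_le_pow_right₀ (by linarith) (by omega)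
    rw [show 3 * c = 2 * c + c by ring, pow_add, mul_inv]
    refine mul_le_mul_of_nonneg_right ?_ (by positivity)
    rw [inv_eq_one_div]
    exact one_div_le_one_div_of_le (by norm_num) h2

/-- The law of the coins of one iteration of the algorithm. -/
noncomputable def stepLaw (V : Type u) [Fintype V] (c n D : ℕ) :
    Measure (IterationCoins V (idLength c n) (logSize n) (numRounds (roundFactor c) n D)) :=
  iterationLaw V n _ _ _

instance (c n D : ℕ) : IsProbabilityMeasure (stepLaw V c n D) := by
  unfold stepLaw; infer_instance

/-- One iteration of the algorithm. -/
noncomputable def step {V : Type u} (G : Digraph V) (c n D : ℕ) (st : V → Status (idLength c n))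
    (r : IterationCoins V (idLength c n) (logSize n) (numRounds (roundFactor c) n D)) :
    V → Status (idLength c n) :=
  iteration G (roundHeight n D) st r

theorem measure_broadcast_le (G : Digraph V) (hG : StronglyConnected G) (c n D : ℕ)
    (hn : n = Fintype.card V) (hn2 : 2 ≤ n) (hD : D = eccentricity G) {M : Type}
    (f : V → Option M) (part : V → Bool) (hpart : ∀ v, part v = true) (hf : ∃ v, f v ≠ none) :
    (Measure.pi fun _ : Fin (numRounds (roundFactor c) n D) => decayLaw V (logSize n))
        {coins | ∃ v, multiBroadcast G (roundHeight n D) part f coins v = none} ≤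
      ENNReal.ofReal (((n : ℝ) ^ (3 * c))⁻¹ / 128) :=
  (measure_exists_multiBroadcast_eq_none_le G hG n D _ hn hn2 hD
    (by unfold roundFactor; omega) f part hpart hf).trans
    (ENNReal.ofReal_le_ofReal (mul_exp_roundFactor_le c n hn2))

/-- A unique candidate appears with probability at least `1 / e > 0.36`, and the first broadcast
loses at most 0.01 of this. -/
theorem le_stepLaw_elected (G : Digraph V) (hG : StronglyConnected G) (c n D : ℕ) (hc : 1 ≤ c)
    (hn : n = Fintype.card V) (hn2 : 2 ≤ n) (hD : D = eccentricity G) :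
    ENNReal.ofReal 0.35 ≤ stepLaw V c n D {r | Elected (step G c n D (initial V _) r)} := by
  have hF := iterationLaw_firstBroadcastFails_le (b := idLength c n) G (roundHeight n D) n _
    fun f part => measure_broadcast_le G hG c n D hn hn2 hD f part
  have hone := le_iterationLaw_exists_only_candidate (V := V) (b := idLength c n)
    (l := logSize n) (Q := numRounds (roundFactor c) n D) n hn hn2
  have hsub : {r : IterationCoins V (idLength c n) (logSize n)
        (numRounds (roundFactor c) n D) | ∃ v, r.1 v = true ∧ ∀ w, w ≠ v → r.1 w = false} ⊆
      {r | Elected (step G c n D (initial V _) r)} ∪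
        {r | FirstBroadcastFails G (roundHeight n D) r} := by
    rintro r ⟨v, hv, hw⟩
    by_cases hr : FirstBroadcastFails G (roundHeight n D) r
    · exact Or.inr hr
    · exact Or.inl (elected_of_only_candidate G _ r v hv hw hr)
  have h1 := (hone.trans (measure_mono hsub)).trans (measure_union_le _ _)
  have hsmall : ENNReal.ofReal (((n : ℝ) ^ (3 * c))⁻¹ / 128) ≤ ENNReal.ofReal 0.01 := by
    apply ENNReal.ofReal_le_ofReal
    have := (inv_pow_three_mul_le c n hc hn2).1
    linarith
  have h2 : ENNReal.ofReal 0.36 ≤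
      stepLaw V c n D {r | Elected (step G c n D (initial V _) r)} + ENNReal.ofReal 0.01 := by
    refine le_trans (ENNReal.ofReal_le_ofReal ?_) (h1.trans (add_le_add le_rfl (hF.trans hsmall)))
    linarith [exp_neg_one_ge]
  rw [show (0.36 : ℝ) = 0.35 + 0.01 by norm_num,
    ENNReal.ofReal_add (by norm_num) (by norm_num)] at h2
  exact (ENNReal.add_le_add_iff_right ENNReal.ofReal_ne_top).1 h2

/-- Two broadcasts contribute `1 / 128` each and detection contributes 1, in units of `n ^ (-3 c)`.
-/
theorem stepLaw_bad_le (G : Digraph V) (hG : StronglyConnected G) (c n D : ℕ)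
    (hn : n = Fintype.card V) (hn2 : 2 ≤ n) (hD : D = eccentricity G) :
    stepLaw V c n D {r | step G c n D (initial V _) r ≠ initial V _ ∧
        ¬ Elected (step G c n D (initial V _) r)} ≤
      ENNReal.ofReal (65 / 64 * ((n : ℝ) ^ (3 * c))⁻¹) := by
  have hF1 := iterationLaw_firstBroadcastFails_le (b := idLength c n) G (roundHeight n D) n _
    fun f part => measure_broadcast_le G hG c n D hn hn2 hD f part
  have hF3 := iterationLaw_secondBroadcastFails_le (b := idLength c n) G (roundHeight n D) n _
    fun f part => measure_broadcast_le G hG c n D hn hn2 hD f part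
  have hF2 := (iterationLaw_detectionFails_le (b := idLength c n) (l := logSize n)
    (Q := numRounds (roundFactor c) n D) G hG (roundHeight n D) n hn hn2
    (one_le_logSize hn2) (le_two_pow_logSize n)).trans
    (ENNReal.ofReal_le_ofReal (missRate_pow_idLength_le c n hn2))
  have hsub : {r : IterationCoins V (idLength c n) (logSize n)
        (numRounds (roundFactor c) n D) | step G c n D (initial V _) r ≠ initial V _ ∧
        ¬ Elected (step G c n D (initial V _) r)} ⊆
      ({r | FirstBroadcastFails G (roundHeight n D) r} ∪
        {r | DetectionFails G (roundHeight n D) r}) ∪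
          {r | SecondBroadcastFails G (roundHeight n D) r} := by
    rintro r ⟨hr1, hr2⟩
    by_contra hno
    simp only [Set.mem_union, Set.mem_ofPred_eq, not_or] at hno
    rcases iteration_initial G (roundHeight n D) r hno.1.1 hno.1.2 hno.2 with h | h
    · exact hr1 h
    · exact hr2 h
  refine ((measure_mono hsub).trans (measure_union_le _ _)).trans
    ((add_le_add ((measure_union_le _ _).trans (add_le_add hF1 hF2)) hF3).trans ?_)
  rw [← ENNReal.ofReal_add (by positivity) (by positivity),
    ← ENNReal.ofReal_add (by positivity) (by positivity)]
  exact ENNReal.ofReal_le_ofReal (by linarith)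

end Initial

/-! ### The expected number of iterations -/

section Chain

variable {V : Type u} [Fintype V]

open Classical in
/-- `1` as long as some node is running. -/
noncomputable def unfinished {b : ℕ} (st : V → Status b) : ℝ≥0∞ :=
  if ∀ v, (st v).isSome then 0 else 1

open Classical in
/-- The number of running nodes. -/
noncomputable def numRunning {b : ℕ} (st : V → Status b) : ℕ :=
  (Finset.univ.filter fun v => st v = none).card

open Classical in
/-- An upper bound for the expected number of further iterations. -/
noncomputable def iterationBound {b : ℕ} (n : ℕ) (st : V → Status b) : ℝ≥0∞ :=
  if st = initial V b then 20 else 3 * n * numRunning st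

open Classical in
/-- An upper bound for the probability that no leader is elected, apart from the case that the
algorithm does not terminate. -/
noncomputable def errorBound {b : ℕ} (c n : ℕ) (st : V → Status b) : ℝ≥0∞ :=
  if Elected st then 0 else if st = initial V b then ENNReal.ofReal (((n : ℝ) ^ c)⁻¹) else 1

theorem numRunning_le {b : ℕ} (st : V → Status b) : numRunning st ≤ Fintype.card V :=
  Finset.card_le_univ _

theorem numRunning_eq_zero {b : ℕ} (st : V → Status b) (h : ∀ v, (st v).isSome) :
    numRunning st = 0 := by
  classical
  unfold numRunning
  rw [Finset.card_eq_zero, Finset.filter_eq_empty_iff]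
  intro v _ hv
  have := h v
  simp [hv] at this

theorem Elected.isSome {V : Type u} {b : ℕ} {st : V → Status b} (h : Elected st) (v : V) : (st v).isSome := by
  obtain ⟨y, hy, -⟩ := h
  obtain ⟨own, ho⟩ := hy v
  simp [ho]

theorem initial_not_isSome {V : Type u} {b : ℕ} [Nonempty V] :
    ¬ ∀ v, (initial V b v).isSome := fun h => by
  obtain ⟨v⟩ := ‹Nonempty V›
  have := h v
  simp [initial] at this

theorem numRunning_step_le {b l Q : ℕ} (G : Digraph V) (h : ℕ → ℕ) (st : V → Status b)
    (r : IterationCoins V b l Q) : numRunning (iteration G h st r) ≤ numRunning st := by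
  classical
  refine Finset.card_le_card fun v hv => ?_
  simp only [Finset.mem_filter, Finset.mem_univ, true_and] at hv ⊢
  by_contra hne
  rw [iteration_of_isSome G h st r v (Option.isSome_iff_ne_none.2 hne)] at hv
  exact hne hv

theorem numRunning_step_lt {b l Q : ℕ} (G : Digraph V) (h : ℕ → ℕ) (st : V → Status b)
    (r : IterationCoins V b l Q) (v : V) (hst : st v = none) (hrv : r.1 v = true)
    (hv : ∀ w, w ≠ v → r.1 w = false) :
    numRunning (iteration G h st r) + 1 ≤ numRunning st := by
  classical
  refine Finset.card_lt_card (Finset.ssubset_iff_of_subset (fun w hw => ?_) |>.2 ⟨v, ?_, ?_⟩)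
  · simp only [Finset.mem_filter, Finset.mem_univ, true_and] at hw ⊢
    by_contra hne
    rw [iteration_of_isSome G h st r w (Option.isSome_iff_ne_none.2 hne)] at hw
    exact hne hw
  · simp [hst]
  · simp only [Finset.mem_filter, Finset.mem_univ, true_and]
    exact Option.isSome_iff_ne_none.1 (iteration_isSome_of_only_candidate G h st r v hst hrv hv)

theorem step_ne_initial {V : Type u} (G : Digraph V) (c n D : ℕ)
    {st : V → Status (idLength c n)} (hst : st ≠ initial V _)
    (r : IterationCoins V (idLength c n) (logSize n) (numRounds (roundFactor c) n D)) :
    step G c n D st r ≠ initial V _ := by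
  intro h
  apply hst
  funext v
  by_contra hne
  have h1 := iteration_of_isSome G (roundHeight n D) st r v (Option.isSome_iff_ne_none.2 hne)
  have h2 : step G c n D st r v = none := congrFun h v
  exact hne (h1.symm.trans h2)

/-- Success lowers the bound from 20 to 0 and gains at least `20 * 0.35 = 7`. Going wrong raises it
to at most `3 n ^ 2`, which costs at most 2 on average. This leaves `1 + 15 ≤ 20`. -/
theorem lintegral_iterationBound_initial_le (G : Digraph V) (hG : StronglyConnected G) (c n D : ℕ)
    (hc : 1 ≤ c) (hn : n = Fintype.card V) (hn2 : 2 ≤ n) (hD : D = eccentricity G) :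
    1 + ∫⁻ r, iterationBound n (step G c n D (initial V _) r) ∂(stepLaw V c n D) ≤ 20 := by
  classical
  have : Nonempty V := Fintype.card_pos_iff.1 (by omega)
  have hgood := le_stepLaw_elected G hG c n D hc hn hn2 hD
  have hbad := stepLaw_bad_le G hG c n D hn hn2 hD
  set good := {r | Elected (step G c n D (initial V _) r)} with hgood_def
  set bad := {r | step G c n D (initial V _) r ≠ initial V _ ∧
        ¬ Elected (step G c n D (initial V _) r)} with hbad_def
  -- Gain on the left, loss on the right: this avoids truncated subtraction in `ℝ≥0∞` and integrates
  -- term by term.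
  have hpt : ∀ r, iterationBound n (step G c n D (initial V _) r) +
      good.indicator (fun _ => (20 : ℝ≥0∞)) r ≤
      20 + bad.indicator (fun _ => (3 * n * n : ℝ≥0∞)) r := by
    intro r
    by_cases h1 : step G c n D (initial V _) r = initial V _
    · have hg : r ∉ good := fun h => initial_not_isSome (h1 ▸ Elected.isSome h)
      have hb : r ∉ bad := fun h => h.1 h1
      rw [Set.indicator_of_notMem hg, Set.indicator_of_notMem hb, iterationBound, if_pos h1]
    · rw [iterationBound, if_neg h1]
      by_cases h2 : Elected (step G c n D (initial V _) r)
      · have hb : r ∉ bad := fun h => h.2 h2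
        rw [Set.indicator_of_notMem hb, Set.indicator_of_mem (by exact h2),
          numRunning_eq_zero _ h2.isSome]
        simp
      · have hg : r ∉ good := h2
        rw [Set.indicator_of_notMem hg, Set.indicator_of_mem (by exact ⟨h1, h2⟩), add_zero]
        refine le_add_left ?_
        gcongr
        exact (numRunning_le _).trans_eq hn.symm
  have hlint_le := lintegral_mono (μ := stepLaw V c n D) hpt
  rw [lintegral_add_right _ (measurable_of_countable _),
    lintegral_add_right _ (measurable_of_countable _),
    lintegral_indicator_const (Set.toFinite _).measurableSet,
    lintegral_indicator_const (Set.toFinite _).measurableSet, lintegral_const, measure_univ,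
    mul_one] at hlint_le
  have h7 : (7 : ℝ≥0∞) ≤ 20 * stepLaw V c n D good := by
    calc (7 : ℝ≥0∞) = 20 * ENNReal.ofReal 0.35 := by
          rw [show (20 : ℝ≥0∞) = ENNReal.ofReal 20 by simp, ← ENNReal.ofReal_mul (by norm_num)]
          norm_num
      _ ≤ _ := by gcongr
  have h2 : 3 * n * n * stepLaw V c n D bad ≤ 2 := by
    calc 3 * n * n * stepLaw V c n D bad ≤
          3 * n * n * ENNReal.ofReal (65 / 64 * ((n : ℝ) ^ (3 * c))⁻¹) := by gcongr
      _ = ENNReal.ofReal (3 * n * n * (65 / 64 * ((n : ℝ) ^ (3 * c))⁻¹)) := by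
          rw [ENNReal.ofReal_mul (by positivity) (p := 3 * n * n),
            ENNReal.ofReal_mul (by positivity), ENNReal.ofReal_mul (by positivity)]
          simp
      _ ≤ ENNReal.ofReal 2 := by
          apply ENNReal.ofReal_le_ofReal
          have := (inv_pow_three_mul_le c n hc hn2).2.1
          nlinarith
      _ = 2 := by simp
  have h3 : ∫⁻ r, iterationBound n (step G c n D (initial V _) r) ∂(stepLaw V c n D) + 7 ≤
      20 + 2 := (add_le_add le_rfl h7).trans (hlint_le.trans (add_le_add le_rfl h2))
  have h4 : ∫⁻ r, iterationBound n (step G c n D (initial V _) r) ∂(stepLaw V c n D) ≤ 15 := by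
    refine (ENNReal.add_le_add_iff_right (a := 7) (by simp)).1 (h3.trans ?_)
    norm_num
  calc _ ≤ (1 : ℝ≥0∞) + 15 := by gcongr
    _ ≤ 20 := by norm_num

/-- Nothing is assumed about how the run went wrong. Any running node is the only candidate with
probability at least `1 / (e n)` and then terminates, holding its own identifier; as `e < 3`, this
lowers `3 n * numRunning` by at least 1 on average. -/
theorem lintegral_iterationBound_le_of_ne (G : Digraph V) (c n D : ℕ) (hn : n = Fintype.card V)
    (hn2 : 2 ≤ n) {st : V → Status (idLength c n)} (hst : st ≠ initial V _) :
    unfinished st + ∫⁻ r, iterationBound n (step G c n D st r) ∂(stepLaw V c n D) ≤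
      iterationBound n st := by
  classical
  have hnext : ∀ r, iterationBound n (step G c n D st r) =
      3 * n * numRunning (step G c n D st r) := fun r => by
    rw [iterationBound, if_neg (step_ne_initial G c n D hst r)]
  simp only [hnext]
  rw [iterationBound, if_neg hst]
  by_cases hall : ∀ v, (st v).isSome
  · rw [unfinished, if_pos hall, zero_add]
    calc _ ≤ ∫⁻ _, (3 * n * numRunning st : ℝ≥0∞) ∂(stepLaw V c n D) := by
          refine lintegral_mono fun r => ?_
          gcongr
          exact numRunning_step_le G _ st r
      _ = _ := by simp
  · rw [unfinished, if_neg hall]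
    push Not at hall
    obtain ⟨v, hv⟩ := hall
    have hv' : st v = none := by simpa using hv
    have hE := le_iterationLaw_only_candidate (V := V) (b := idLength c n) (l := logSize n)
      (Q := numRounds (roundFactor c) n D) n hn hn2 v
    set E := {r : IterationCoins V (idLength c n) (logSize n)
        (numRounds (roundFactor c) n D) | r.1 v = true ∧ ∀ w, w ≠ v → r.1 w = false} with hEdef
    have hpt : ∀ r, (3 * n * numRunning (step G c n D st r) : ℝ≥0∞) +
        E.indicator (fun _ => (3 * n : ℝ≥0∞)) r ≤ 3 * n * numRunning st := by
      intro r
      by_cases hr : r ∈ E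
      · rw [Set.indicator_of_mem hr]
        calc (3 * n * numRunning (step G c n D st r) : ℝ≥0∞) + 3 * n =
              3 * n * ((numRunning (step G c n D st r) + 1 : ℕ) : ℝ≥0∞) := by
                push_cast; ring
          _ ≤ _ := by
            gcongr
            exact numRunning_step_lt G _ st r v hv' hr.1 hr.2
      · rw [Set.indicator_of_notMem hr, add_zero]
        gcongr
        exact numRunning_step_le G _ st r
    have hlint_le := lintegral_mono (μ := stepLaw V c n D) hpt
    rw [lintegral_add_right _ (measurable_of_countable _),
      lintegral_indicator_const (Set.toFinite _).measurableSet, lintegral_const, measure_univ,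
      mul_one] at hlint_le
    have h1 : (1 : ℝ≥0∞) ≤ 3 * n * stepLaw V c n D E := by
      calc (1 : ℝ≥0∞) ≤ ENNReal.ofReal (3 * n * ((n : ℝ)⁻¹ * Real.exp (-1))) := by
            rw [← ENNReal.ofReal_one]
            apply ENNReal.ofReal_le_ofReal
            have hn0 : (n : ℝ) ≠ 0 := by positivity
            rw [mul_assoc, mul_inv_cancel_left₀ hn0]
            linarith [exp_neg_one_ge]
        _ = 3 * n * ENNReal.ofReal ((n : ℝ)⁻¹ * Real.exp (-1)) := by
            rw [ENNReal.ofReal_mul (by positivity), ENNReal.ofReal_mul (by positivity)]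
            simp
        _ ≤ _ := by gcongr; exact hE
    rw [add_comm]
    exact (add_le_add le_rfl h1).trans hlint_le

theorem unfinished_add_lintegral_le (G : Digraph V) (hG : StronglyConnected G) (c n D : ℕ)
    (hc : 1 ≤ c) (hn : n = Fintype.card V) (hn2 : 2 ≤ n) (hD : D = eccentricity G)
    (st : V → Status (idLength c n)) :
    unfinished st + ∫⁻ r, iterationBound n (step G c n D st r) ∂(stepLaw V c n D) ≤
      iterationBound n st := by
  classical
  by_cases hst : st = initial V _
  · have h := lintegral_iterationBound_initial_le G hG c n D hc hn hn2 hD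
    rw [hst]
    rw [iterationBound, if_pos rfl]
    refine (add_le_add ?_ le_rfl).trans h
    unfold unfinished
    split_ifs <;> simp
  · exact lintegral_iterationBound_le_of_ne G c n D hn hn2 hst

/-- Elected states are absorbing. From the initial state the increase to 1 on bad outcomes is offset
by the decrease to 0 on good ones, because `P(bad) ≤ n ^ (-c) * P(good)`. -/
theorem lintegral_errorBound_le (G : Digraph V) (hG : StronglyConnected G) (c n D : ℕ)
    (hc : 1 ≤ c) (hn : n = Fintype.card V) (hn2 : 2 ≤ n) (hD : D = eccentricity G)
    (st : V → Status (idLength c n)) :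
    ∫⁻ r, errorBound c n (step G c n D st r) ∂(stepLaw V c n D) ≤ errorBound c n st := by
  classical
  by_cases hel : Elected st
  · have : ∀ r, step G c n D st r = st := fun r => hel.iteration_eq G _ r
    simp [this]
  have hβ : ENNReal.ofReal (((n : ℝ) ^ c)⁻¹) ≤ 1 := by
    rw [ENNReal.ofReal_le_one]
    apply inv_le_one_of_one_le₀
    apply one_le_pow₀
    exact_mod_cast (by omega : 1 ≤ n)
  have hle1 : ∀ st : V → Status (idLength c n), errorBound c n st ≤ 1 := by
    intro st
    unfold errorBound
    split_ifs
    · simp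
    · exact hβ
    · exact le_rfl
  by_cases hst : st = initial V _
  swap
  · have h1 : errorBound c n st = 1 := by rw [errorBound, if_neg hel, if_neg hst]
    rw [h1]
    calc _ ≤ ∫⁻ _, (1 : ℝ≥0∞) ∂(stepLaw V c n D) := lintegral_mono fun r => hle1 _
      _ = 1 := by simp
  subst hst
  have : Nonempty V := Fintype.card_pos_iff.1 (by omega)
  have hgood := le_stepLaw_elected G hG c n D hc hn hn2 hD
  have hbad := stepLaw_bad_le G hG c n D hn hn2 hD
  set good := {r | Elected (step G c n D (initial V _) r)} with hgood_def
  set bad := {r | step G c n D (initial V _) r ≠ initial V _ ∧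
        ¬ Elected (step G c n D (initial V _) r)} with hbad_def
  set β := ENNReal.ofReal (((n : ℝ) ^ c)⁻¹) with hβdef
  have hpt : ∀ r, errorBound c n (step G c n D (initial V _) r) +
      good.indicator (fun _ => β) r ≤ β + bad.indicator (fun _ => (1 : ℝ≥0∞)) r := by
    intro r
    by_cases h2 : Elected (step G c n D (initial V _) r)
    · have hb : r ∉ bad := fun h => h.2 h2
      rw [Set.indicator_of_notMem hb, Set.indicator_of_mem (by exact h2), errorBound, if_pos h2]
      simp
    · have hg : r ∉ good := h2
      rw [Set.indicator_of_notMem hg, errorBound, if_neg h2, add_zero]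
      by_cases h1 : step G c n D (initial V _) r = initial V _
      · rw [if_pos h1]; exact le_self_add
      · rw [if_neg h1, Set.indicator_of_mem (by exact ⟨h1, h2⟩)]; exact le_add_self
  have hlint_le := lintegral_mono (μ := stepLaw V c n D) hpt
  rw [lintegral_add_right _ (measurable_of_countable _),
    lintegral_add_right _ (measurable_of_countable _),
    lintegral_indicator_const (Set.toFinite _).measurableSet,
    lintegral_indicator_const (Set.toFinite _).measurableSet, lintegral_const, measure_univ,
    mul_one, one_mul] at hlint_le
  have hcmp : stepLaw V c n D bad ≤ β * stepLaw V c n D good := by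
    calc stepLaw V c n D bad ≤ ENNReal.ofReal (65 / 64 * ((n : ℝ) ^ (3 * c))⁻¹) := hbad
      _ ≤ ENNReal.ofReal (((n : ℝ) ^ c)⁻¹ * 0.35) := by
          apply ENNReal.ofReal_le_ofReal
          have h1 := (inv_pow_three_mul_le c n hc hn2).2.2
          have h2 : (0 : ℝ) ≤ ((n : ℝ) ^ c)⁻¹ := by positivity
          linarith
      _ = β * ENNReal.ofReal 0.35 := by rw [ENNReal.ofReal_mul (by positivity)]
      _ ≤ _ := by gcongr
  have hfin : β * stepLaw V c n D good ≠ ⊤ :=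
    ENNReal.mul_ne_top ENNReal.ofReal_ne_top (measure_ne_top _ _)
  have hrhs : errorBound c n (initial V (idLength c n)) = β := by
    rw [errorBound, if_neg hel, if_pos rfl]
  rw [hrhs]
  exact (ENNReal.add_le_add_iff_right hfin).1 (hlint_le.trans (add_le_add le_rfl hcmp))

end Chain

/-! ### The whole run -/

section Run

variable {V : Type u} [Fintype V]

theorem run_eq_chain {V : Type u} {b l Q : ℕ} (G : Digraph V) (h : ℕ → ℕ) (ω : Coins V b l Q) (k : ℕ) :
    run G h ω k = chain (iteration G h) (initial V b) ω k := by
  induction k with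
  | zero => rfl
  | succ k ih => rw [run, chain, ih]

/-- The sum counts the iterations before termination. If the run never ends, the sum is infinite,
and `T ≠ 0` keeps the product infinite. -/
theorem runningTime_le_tsum {b l Q : ℕ} (G : Digraph V) (h : ℕ → ℕ) (T : ℕ) (hT : T ≠ 0)
    (ω : Coins V b l Q) :
    runningTime G h T ω ≤ T * ∑' k, unfinished (run G h ω k) := by
  classical
  by_cases hex : ∃ k, ∀ v, (run G h ω k v).isSome
  · have hle : runningTime G h T ω ≤ ((T * Nat.find hex : ℕ) : ℝ≥0∞) :=
      iInf₂_le (Nat.find hex) (Nat.find_spec hex)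
    refine hle.trans ?_
    rw [Nat.cast_mul]
    gcongr
    refine le_trans ?_ (ENNReal.sum_le_tsum (Finset.range (Nat.find hex)))
    have h1 : ∀ k ∈ Finset.range (Nat.find hex), unfinished (run G h ω k) = 1 := fun k hk =>
      if_neg (Nat.find_min hex (Finset.mem_range.1 hk))
    rw [Finset.sum_congr rfl h1]
    simp
  · have h1 : ∀ k, unfinished (run G h ω k) = 1 := fun k => if_neg fun hk => hex ⟨k, hk⟩
    simp [h1, ENNReal.mul_top, hT]

theorem iterationSteps_ne_zero (c K n D : ℕ) (hc : 1 ≤ c) (hn2 : 2 ≤ n) :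
    iterationSteps c K n D ≠ 0 := by
  have h := one_le_logSize hn2
  have : 0 < idLength c n * 4 * logSize n := by unfold idLength; positivity
  unfold iterationSteps
  omega

theorem tsum_lintegral_unfinished_le (G : Digraph V) (hG : StronglyConnected G) (c n D : ℕ)
    (hc : 1 ≤ c) (hn : n = Fintype.card V) (hn2 : 2 ≤ n) (hD : D = eccentricity G) :
    ∑' k, ∫⁻ ω, unfinished (run G (roundHeight n D) ω k)
      ∂(algorithmLaw c (roundFactor c) n D V) ≤ 20 := by
  classical
  have h := tsum_lintegral_chain_le (stepLaw V c n D) (step G c n D) (initial V _) unfinished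
    (iterationBound n) (unfinished_add_lintegral_le G hG c n D hc hn hn2 hD)
  rw [iterationBound, if_pos rfl] at h
  simp only [run_eq_chain]
  exact h

theorem lintegral_runningTime_le (G : Digraph V) (hG : StronglyConnected G) (c n D : ℕ)
    (hc : 1 ≤ c) (hn : n = Fintype.card V) (hn2 : 2 ≤ n) (hD : D = eccentricity G) :
    ∫⁻ ω, runningTime G (roundHeight n D) (iterationSteps c (roundFactor c) n D) ω
      ∂(algorithmLaw c (roundFactor c) n D V) ≤
        iterationSteps c (roundFactor c) n D * 20 := by
  let _ : MeasurableSpace (V → Status (idLength c n)) := ⊤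
  have hmeas : ∀ k, Measurable fun ω : Coins V (idLength c n) (logSize n)
      (numRounds (roundFactor c) n D) => unfinished (run G (roundHeight n D) ω k) := by
    intro k
    simp only [run_eq_chain]
    exact (Measurable.of_discrete (f := unfinished)).comp (measurable_chain _ _ k)
  calc _ ≤ ∫⁻ ω, iterationSteps c (roundFactor c) n D *
          ∑' k, unfinished (run G (roundHeight n D) ω k)
            ∂(algorithmLaw c (roundFactor c) n D V) :=
        lintegral_mono fun ω =>
          runningTime_le_tsum G _ _ (iterationSteps_ne_zero c _ n D hc hn2) ω
    _ = iterationSteps c (roundFactor c) n D * ∑' k,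
          ∫⁻ ω, unfinished (run G (roundHeight n D) ω k)
            ∂(algorithmLaw c (roundFactor c) n D V) := by
        rw [lintegral_const_mul _ (Measurable.tsum hmeas),
          lintegral_tsum fun k => (hmeas k).aemeasurable]
    _ ≤ _ := by
        gcongr
        exact tsum_lintegral_unfinished_le G hG c n D hc hn hn2 hD

theorem one_le_errorBound_add_unfinished {b : ℕ} [Nonempty V] (c n : ℕ) (st : V → Status b)
    (hst : ¬ Elected st) : 1 ≤ errorBound c n st + unfinished st := by
  classical
  by_cases h : st = initial V b
  · subst h
    rw [unfinished, if_neg initial_not_isSome]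
    exact le_add_self
  · rw [errorBound, if_neg hst, if_neg h]
    exact le_self_add

/-- At each time `k` the run is elected, or accounted for by `errorBound`, or unfinished. The last
probability tends to 0 because its sum over `k` is finite, so letting `k` grow leaves only the error
`n ^ (-c)`. -/
theorem le_algorithmLaw_electsLeader (G : Digraph V) (hG : StronglyConnected G) (c n D : ℕ)
    (hc : 1 ≤ c) (hn : n = Fintype.card V) (hn2 : 2 ≤ n) (hD : D = eccentricity G) :
    ENNReal.ofReal (1 - 1 / (n : ℝ) ^ c) ≤ algorithmLaw c (roundFactor c) n D V
      {ω | ElectsLeader G (roundHeight n D) ω} := by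
  classical
  have : Nonempty V := Fintype.card_pos_iff.1 (by omega)
  have hprob : IsProbabilityMeasure (algorithmLaw c (roundFactor c) n D V) := by
    unfold algorithmLaw; infer_instance
  let _ : MeasurableSpace (V → Status (idLength c n)) := ⊤
  set μ := algorithmLaw c (roundFactor c) n D V with hμ
  set β := ENNReal.ofReal (((n : ℝ) ^ c)⁻¹) with hβ
  have hmeas : ∀ k, Measurable fun ω : Coins V (idLength c n) (logSize n)
      (numRounds (roundFactor c) n D) => run G (roundHeight n D) ω k := by
    intro k
    simp only [run_eq_chain]
    exact measurable_chain _ _ k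
  have hmeas_err : ∀ k, Measurable fun ω : Coins V (idLength c n) (logSize n)
      (numRounds (roundFactor c) n D) => errorBound c n (run G (roundHeight n D) ω k) :=
    fun k => (Measurable.of_discrete (f := errorBound c n)).comp (hmeas k)
  have herr : ∀ k, ∫⁻ ω, errorBound c n (run G (roundHeight n D) ω k) ∂μ ≤ β := by
    intro k
    have h := lintegral_chain_le (stepLaw V c n D) (step G c n D) (initial V _)
      (errorBound c n) (lintegral_errorBound_le G hG c n D hc hn hn2 hD) k
    have hnot : ¬ Elected (initial V (idLength c n)) := fun h => initial_not_isSome h.isSome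
    rw [errorBound, if_neg hnot, if_pos rfl] at h
    simp only [run_eq_chain]
    exact h
  have hlim : Filter.Tendsto
      (fun k => ∫⁻ ω, unfinished (run G (roundHeight n D) ω k) ∂μ) Filter.atTop (nhds 0) := by
    refine ENNReal.tendsto_atTop_zero_of_tsum_ne_top ?_
    exact ne_top_of_le_ne_top (by simp) (tsum_lintegral_unfinished_le G hG c n D hc hn hn2 hD)
  have hk : ∀ k, 1 ≤ μ {ω | ElectsLeader G (roundHeight n D) ω} + β +
      ∫⁻ ω, unfinished (run G (roundHeight n D) ω k) ∂μ := by
    intro k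
    have hset : MeasurableSet {ω : Coins V (idLength c n) (logSize n)
        (numRounds (roundFactor c) n D) | Elected (run G (roundHeight n D) ω k)} :=
      hmeas k (MeasurableSet.of_discrete (s := {st | Elected st}))
    have hpt : ∀ ω, 1 ≤ {ω : Coins V (idLength c n) (logSize n)
        (numRounds (roundFactor c) n D) | Elected (run G (roundHeight n D) ω k)}.indicator
          (fun _ => (1 : ℝ≥0∞)) ω + (errorBound c n (run G (roundHeight n D) ω k) +
            unfinished (run G (roundHeight n D) ω k)) := by
      intro ω
      by_cases hel : Elected (run G (roundHeight n D) ω k)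
      · rw [Set.indicator_of_mem (by exact hel)]
        exact le_self_add
      · exact (one_le_errorBound_add_unfinished c n _ hel).trans le_add_self
    have hlint_le := lintegral_mono (μ := μ) hpt
    rw [lintegral_const, measure_univ, mul_one, lintegral_add_left
      (measurable_const.indicator hset), lintegral_indicator_const hset, one_mul,
      lintegral_add_left (hmeas_err k), ← add_assoc] at hlint_le
    refine hlint_le.trans (add_le_add (add_le_add (measure_mono ?_) (herr k)) le_rfl)
    rintro ω ⟨y, hy⟩
    exact ⟨k, y, hy⟩
  have h1 : 1 ≤ μ {ω | ElectsLeader G (roundHeight n D) ω} + β + 0 :=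
    ge_of_tendsto' (hlim.const_add _) hk
  rw [add_zero] at h1
  rw [ENNReal.ofReal_sub _ (by positivity), ENNReal.ofReal_one, one_div]
  exact tsub_le_iff_right.2 h1

end Run

/-! ### The length of an iteration -/

/-- The sum is the exponent of 2 in `Q!`, which by Legendre's formula is `Q` minus the binary digit
sum of `Q`. -/
theorem sum_padicValNat_succ_le (Q : ℕ) :
    ∑ q ∈ Finset.range Q, padicValNat 2 (q + 1) ≤ Q := by
  have h : ∑ q ∈ Finset.range Q, padicValNat 2 (q + 1) = padicValNat 2 Q.factorial := by
    induction Q with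
    | zero => simp
    | succ Q ih =>
      rw [Finset.sum_range_succ, ih, Nat.factorial_succ,
        padicValNat.mul (by omega) (Nat.factorial_ne_zero Q), add_comm]
  rw [h]
  have := sub_one_mul_padicValNat_factorial (p := 2) Q
  simp only [Nat.add_one_sub_one, one_mul] at this
  omega

theorem sum_range_mod_eq_zero_le (g l Q : ℕ) :
    ∑ q ∈ Finset.range Q, (if q % g = 0 then l else 0) ≤ (Q / g + 1) * l := by
  rw [← Finset.sum_filter, Finset.sum_const, smul_eq_mul]
  gcongr
  calc ((Finset.range Q).filter fun q => q % g = 0).card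
      ≤ ((Finset.range (Q / g + 1)).image fun i => g * i).card := by
        refine Finset.card_le_card fun q hq => ?_
        simp only [Finset.mem_filter, Finset.mem_range] at hq
        rw [Finset.mem_image]
        refine ⟨q / g, ?_, Nat.mul_div_cancel' (Nat.dvd_of_mod_eq_zero hq.2)⟩
        rw [Finset.mem_range]
        exact Nat.lt_succ_of_le (Nat.div_le_div_right hq.1.le)
    _ ≤ Q / g + 1 := Finset.card_image_le.trans (by simp)

theorem logSize_le_fullPeriod_mul (n D : ℕ) : logSize n ≤ fullPeriod n D * logRatio n D := by
  have h : 0 < logRatio n D := Nat.succ_pos _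
  have h1 := Nat.div_add_mod (logSize n) (logRatio n D)
  have h2 := Nat.mod_lt (logSize n) h
  rw [fullPeriod, add_mul, one_mul, mul_comm]
  omega

/-- Full rounds cost `(Q / g + 1) ℓ ≤ Q λ + ℓ` since `ℓ ≤ g λ`; the other rounds cost at most `Q λ +
Q ≤ 2 Q λ`. -/
theorem broadcastSteps_le (K n D : ℕ) :
    broadcastSteps K n D ≤ 3 * (logRatio n D * numRounds K n D) + logSize n := by
  have hr : 1 ≤ logRatio n D := Nat.succ_pos _
  set Q := numRounds K n D with hQ
  have h1 : broadcastSteps K n D ≤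
      ∑ q ∈ Finset.range Q, (if q % fullPeriod n D = 0 then logSize n else 0) +
        ∑ q ∈ Finset.range Q, (logRatio n D + padicValNat 2 (q + 1)) := by
    rw [← Finset.sum_add_distrib]
    refine Finset.sum_le_sum fun q _ => ?_
    unfold roundHeight
    split_ifs
    · omega
    · rw [zero_add]; exact min_le_right _ _
  have h2 := sum_range_mod_eq_zero_le (fullPeriod n D) (logSize n) Q
  have h3 := sum_padicValNat_succ_le Q
  have h4 : Q / fullPeriod n D * logSize n ≤ Q * logRatio n D := by
    calc Q / fullPeriod n D * logSize n
        ≤ Q / fullPeriod n D * (fullPeriod n D * logRatio n D) :=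
          Nat.mul_le_mul_left _ (logSize_le_fullPeriod_mul n D)
      _ = Q / fullPeriod n D * fullPeriod n D * logRatio n D := by ring
      _ ≤ Q * logRatio n D := Nat.mul_le_mul_right _ (Nat.div_mul_le_self _ _)
  rw [Finset.sum_add_distrib, Finset.sum_const, Finset.card_range, smul_eq_mul] at h1
  have h5 : Q ≤ Q * logRatio n D := Nat.le_mul_of_pos_right _ hr
  rw [add_mul, one_mul] at h2
  rw [mul_comm (logRatio n D) Q]
  omega

theorem logRatio_le_two_mul_logSize (n D : ℕ) (hn2 : 2 ≤ n) :
    logRatio n D ≤ 2 * logSize n := by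
  have h1 : Nat.log 2 (n / D) ≤ Nat.log 2 n := Nat.log_mono_right (Nat.div_le_self n D)
  have h2 : Nat.log 2 n ≤ Nat.clog 2 n := Nat.log_le_clog 2 n
  have h3 := one_le_logSize hn2
  unfold logRatio logSize at *
  omega

theorem iterationSteps_le (c K n D : ℕ) (hn2 : 2 ≤ n) :
    iterationSteps c K n D ≤ (18 * K + 64 * c + 2) * (D * logRatio n D + logSize n ^ 2) := by
  have h1 := broadcastSteps_le K n D
  have h2 := logRatio_le_two_mul_logSize n D hn2
  have h3 := one_le_logSize hn2
  set l := logSize n with hl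
  set r := logRatio n D with hr
  -- Here `λ g ≤ ℓ + λ` and `λ ≤ 2 ℓ`, so the `ℓ g` extra rounds of a broadcast contribute only `O(ℓ
  -- ^ 2)` steps.
  have h4 : r * fullPeriod n D ≤ 3 * l := by
    have : r * (l / r) ≤ l := Nat.mul_div_le l r
    rw [fullPeriod, ← hl, ← hr, mul_add, mul_one]
    omega
  have h5 : r * numRounds K n D ≤ K * (D * r + 3 * l ^ 2) := by
    calc r * numRounds K n D = K * (D * r + l * (r * fullPeriod n D)) := by
          rw [numRounds]; ring
      _ ≤ K * (D * r + l * (3 * l)) := by gcongr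
      _ = _ := by ring
  have h6 : l ≤ l ^ 2 := Nat.le_self_pow (by norm_num) l
  unfold iterationSteps idLength
  rw [← hl]
  nlinarith [Nat.zero_le (K * (D * r)), Nat.zero_le (c * (D * r)), Nat.zero_le (D * r)]

theorem logSize_le_two_mul_logb (n : ℕ) (hn2 : 2 ≤ n) :
    (logSize n : ℝ) ≤ 2 * Real.logb 2 n := by
  have hn : (2 : ℝ) ≤ n := by exact_mod_cast hn2
  have h1 : (1 : ℝ) ≤ Real.logb 2 n := by
    rw [Real.le_logb_iff_rpow_le (by norm_num) (by linarith)]; simpa using hn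
  have h2 : ((logSize n - 1 : ℕ) : ℝ) ≤ Real.logb 2 n := by
    rw [Real.le_logb_iff_rpow_le (by norm_num) (by linarith), Real.rpow_natCast]
    have := Nat.pow_pred_clog_lt_self (b := 2) (by norm_num) (x := n) (by omega)
    exact_mod_cast this.le
  rw [Nat.cast_sub (one_le_logSize hn2)] at h2
  push_cast at h2
  linarith

theorem logRatio_le_two_mul_max (n D : ℕ) :
    (logRatio n D : ℝ) ≤ 2 * max 1 (Real.logb 2 ((n : ℝ) / D)) := by
  have h1 : (1 : ℝ) ≤ max 1 (Real.logb 2 ((n : ℝ) / D)) := le_max_left _ _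
  -- The integer quotient vanishes for `D = 0` or `n < D`; then `logRatio` is 1, which the first
  -- argument of the maximum covers.
  rcases Nat.eq_zero_or_pos (n / D) with h0 | hpos
  · rw [logRatio, h0]
    simp only [Nat.log_zero_right, zero_add, Nat.cast_one]
    linarith
  · have h2 : (Nat.log 2 (n / D) : ℝ) ≤ Real.logb 2 ((n : ℝ) / D) := by
      have hle : ((2 ^ Nat.log 2 (n / D) : ℕ) : ℝ) ≤ (n : ℝ) / D :=
        le_trans (by exact_mod_cast Nat.pow_log_le_self 2 hpos.ne') Nat.cast_div_le
      push_cast at hle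
      rw [Real.le_logb_iff_rpow_le (by norm_num) (lt_of_lt_of_le (by positivity) hle),
        Real.rpow_natCast]
      exact hle
    have h3 := le_max_right (1 : ℝ) (Real.logb 2 ((n : ℝ) / D))
    rw [logRatio]
    push_cast
    linarith

theorem iterationSteps_le_logb (c K n D : ℕ) (hn2 : 2 ≤ n) :
    (iterationSteps c K n D : ℝ) ≤ (4 * (18 * K + 64 * c + 2)) *
      (D * max 1 (Real.logb 2 ((n : ℝ) / D)) + Real.logb 2 n ^ 2) := by
  have h1 : (iterationSteps c K n D : ℝ) ≤
      (18 * K + 64 * c + 2) * (D * logRatio n D + (logSize n : ℝ) ^ 2) := by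
    exact_mod_cast iterationSteps_le c K n D hn2
  have h2 := logSize_le_two_mul_logb n hn2
  have h3 := logRatio_le_two_mul_max n D
  have h4 : (D : ℝ) * logRatio n D + (logSize n : ℝ) ^ 2 ≤
      4 * (D * max 1 (Real.logb 2 ((n : ℝ) / D)) + Real.logb 2 n ^ 2) := by
    have h5 : (logSize n : ℝ) ^ 2 ≤ (2 * Real.logb 2 n) ^ 2 := by gcongr
    have h6 : (D : ℝ) * logRatio n D ≤ D * (2 * max 1 (Real.logb 2 ((n : ℝ) / D))) := by gcongr
    have h7 : (0 : ℝ) ≤ D * max 1 (Real.logb 2 ((n : ℝ) / D)) := by positivity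
    nlinarith
  calc (iterationSteps c K n D : ℝ) ≤ _ := h1
    _ ≤ (18 * K + 64 * c + 2) *
        (4 * (D * max 1 (Real.logb 2 ((n : ℝ) / D)) + Real.logb 2 n ^ 2)) := by gcongr
    _ = _ := by ring

end RadioLE

theorem theorem1 (c : ℕ) (hc : 1 ≤ c) :
    ∃ (K : ℕ) (A : ℝ), ∀ (V : Type*) [Fintype V] (G : Digraph V) (n D : ℕ),
      RadioLE.StronglyConnected G → n = Fintype.card V → 2 ≤ n → D = RadioLE.eccentricity G →
        (∫⁻ ω, RadioLE.runningTime G (RadioLE.roundHeight n D) (RadioLE.iterationSteps c K n D) ω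
            ∂(RadioLE.algorithmLaw c K n D V) ≤
          ENNReal.ofReal
            (A * (D * max 1 (Real.logb 2 ((n : ℝ) / D)) + Real.logb 2 n ^ 2))) ∧
        (ENNReal.ofReal (1 - 1 / (n : ℝ) ^ c) ≤
          RadioLE.algorithmLaw c K n D V
            {ω | RadioLE.ElectsLeader G (RadioLE.roundHeight n D) ω}) := by
  -- At most 20 expected iterations, times the bound for the length of one; the 4 pays for the
  -- roundings of the logarithms.
  refine ⟨RadioLE.roundFactor c, 20 * (4 * (18 * RadioLE.roundFactor c + 64 * c + 2)), ?_⟩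
  intro V _ G n D hG hn hn2 hD
  refine ⟨?_, RadioLE.le_algorithmLaw_electsLeader G hG c n D hc hn hn2 hD⟩
  refine (RadioLE.lintegral_runningTime_le G hG c n D hc hn hn2 hD).trans ?_
  rw [mul_comm, mul_assoc, ENNReal.ofReal_mul (by norm_num), ENNReal.ofReal_ofNat]
  gcongr
  rw [← ENNReal.ofReal_natCast]
  exact ENNReal.ofReal_le_ofReal (RadioLE.iterationSteps_le_logb c _ n D hn2)
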